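/- **Setting.** Let $G=([n],E,w)$ be a finite simple graph with edge weights $w_{ij}>0$. The EPR Hamiltonian on $n$ qubits is $H(G)=\sum_{(i,j)\in E}w_{ij}h_{ij}$, $h_{ij}=\tfrac12(I_iI_j+X_iX_j-Y_iY_j+Z_iZ_j)$. Let $\mathcal P_2$ be the set of Pauli monomials on $n$ qubits with at most two non-identity factors. The level-2 moment matrices are the real symmetric $\Gamma\in\mathbb R^{\mathcal P_2\times\mathcal P_2}$ with $\Gamma\succeq 0$, $\Gamma(A,A)=1$, $\Gamma(A,B)=\pm\Gamma(A',B')$ whenever $AB=\pm A'B'$, and $\Gamma(A,B)=0$ whenever $AB$ is not Hermitian; write $L(AB)=\Gamma(A,B)$, extended linearly. The level-2 quantum moment-SoS relaxation maximizes $L(H(G))$ over these $\Gamma$; an optimal solution gives $g_{ij}=\tfrac12(-1+L(X_iX_j)-L(Y_iY_j)+L(Z_iZ_j))$ and $u(G)=\sum_{(i,j)\in E}w_{ij}(1+g_{ij})$. **Algorithm 1** with angle function $\nu$ computes such an optimal solution and outputs $$|\psi_G\rangle=\prod_{(i,j)\in E}\exp\!\Big(\tfrac{\mathbf i\,\nu(g_{ij})}{4}(X_i-Y_i)\otimes(X_j-Y_j)\Big)|0\rangle^{\otimes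 n}.$$ It has approximation ratio at least $a$ if, for every weighted graph $G$, an optimal solution exists and, whichever optimal solution is used, $a\,\lambda_{\max}(H(G))\le\langle\psi_G|H(G)|\psi_G\rangle\le\lambda_{\max}(H(G))$. Put $$\ell(G)=\sum_{(i,j)\in E}w_{ij}\frac{1+A_{ij}A_{ji}+(A_{ij}+A_{ji})\sin\nu(g_{ij})}{2},\quad A_{ij}=\prod_{k\in N(i)\setminus\{j\}}\cos\nu(g_{ik}),\qquad \alpha=\inf_G\frac{\ell(G)}{u(G)},$$ the infimum being over all weighted graphs with at least one edge and all optimal solutions. **Parameters.** Write $x^+=\max\{x,0\}$, $R(x)=\tfrac12(\sqrt{3(1-x^2)}-x)$, and $Q(x)=1-x$ for $0\le x\le\frac12$, $Q(x)=R(x)$ for $\frac12<x\le\frac{\sqrt3}2$, $Q(x)=0$ for $\frac{\sqrt3}2<x\le1$. Let $\mathcal C$ be the set of monotonically increasing (not necessarily strictly) $\Theta:[0,1]\to[0,1]$ with $\Theta(0)=0$ and $\prod_{i=1}^p(1-\Theta(x_i))\ge1-\Theta(\sum_{i=1}^p x_i)$ for all $x_1,\dots,x_p\in[0,1]$ with $\sum_i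 x_i\le1$. For $\Theta\in\mathcal C$, $\Lambda:[0,1]\to[0,1]$, let $$f(x,y)=\sqrt{(1-\Lambda(y^+))(1-\Theta(Q(y^+)-x^+))},\qquad f^*(x)=f(x,R(x)).$$ For $\frac12<\beta\le1$ let $\mathcal D_{\Theta,\beta}$ be the set of $\Lambda:[0,1]\to[0,1]$ such that $f(x,y)\ge f^*(x)$ whenever $-1\le x\le R(\beta)$ and $\beta\le y\le R(x)$. Define $$r_1(g)=\frac{2-\Theta(Q(g^+))+2\sqrt{\Theta(g^+)(1-\Theta(Q(g^+)))}}{2(1+g)},\quad r_2(g)=\frac{2-\Theta(Q(g^+))+2\sqrt{\Lambda(g^+)(1-\Theta(Q(g^+)))}}{2(1+g)},$$ $$r_3(g)=\frac{1+f^*(g)^2+2\sqrt{\Theta(g^+)}\,f^*(g)}{2(1+g)}.$$ **Claim.** Let $\frac12<\beta\le1$, $\Theta\in\mathcal C$, $\Lambda\in\mathcal D_{\Theta,\beta}$, and let $\nu(x)=\arcsin\sqrt{\Theta(x^+)}$ for $x\le\beta$ and $\nu(x)=\arcsin\sqrt{\Lambda(x^+)}$ for $x>\beta$. Then Algorithm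 1 with this $\nu$ has approximation ratio at least $\alpha$, and $$\alpha\ \ge\ \min\Big\{\inf_{0\le g\le\beta}r_1(g),\ \inf_{\beta\le g\le1}r_2(g),\ \inf_{-1<g\le R(\beta)}r_3(g)\Big\};$$ in particular its approximation ratio is at least the right-hand side. -/

import Mathlib

namespace EPR

noncomputable section

open Finset

/-! ### Operators on `n` qubits -/

/-- Operators on `n` qubits, as matrices in the computational basis `Fin n → Fin 2`. -/
abbrev Op (n : ℕ) : Type := Matrix (Fin n → Fin 2) (Fin n → Fin 2) ℂ

/-- The tensor product `A₁ ⊗ ⋯ ⊗ Aₙ` of one-qubit operators. -/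
def tensorOp {n : ℕ} (A : Fin n → Matrix (Fin 2) (Fin 2) ℂ) : Op n :=
  Matrix.of fun s t => ∏ k, A k (s k) (t k)

theorem tensorOp_mul {n : ℕ} (A B : Fin n → Matrix (Fin 2) (Fin 2) ℂ) :
    tensorOp A * tensorOp B = tensorOp (fun k => A k * B k) := by
  ext s t
  simp only [tensorOp, Matrix.mul_apply, Matrix.of_apply, Finset.prod_univ_sum,
    Fintype.piFinset_univ, Finset.prod_mul_distrib]

/-- Labels of the one-qubit Pauli operators. -/
inductive Pauli
  | I | X | Y | Z
  deriving DecidableEq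

instance : Fintype Pauli := ⟨{.I, .X, .Y, .Z}, fun x => by cases x <;> decide⟩

/-- The Pauli matrices. -/
def Pauli.mat : Pauli → Matrix (Fin 2) (Fin 2) ℂ
  | .I => 1
  | .X => !![0, 1; 1, 0]
  | .Y => !![0, -Complex.I; Complex.I, 0]
  | .Z => !![1, 0; 0, -1]

/-- The operator acting as `σ` on qubit `i` and trivially elsewhere: `X_i`, `Y_i`, `Z_i`. -/
def site {n : ℕ} (σ : Pauli) (i : Fin n) : Op n :=
  tensorOp (fun k => if k = i then σ.mat else 1)

theorem site_commute {n : ℕ} (σ τ : Pauli) {i j : Fin n} (h : i ≠ j) :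
    Commute (site σ i) (site τ j) := by
  unfold Commute SemiconjBy site
  rw [tensorOp_mul, tensorOp_mul]
  congr 1
  funext k
  by_cases hi : k = i
  · subst hi
    simp [h]
  · simp [hi]

/-- `X_i - Y_i`. -/
def xMinusY {n : ℕ} (i : Fin n) : Op n := site .X i - site .Y i

theorem xMinusY_commute {n : ℕ} (i j : Fin n) :
    Commute (xMinusY i) (xMinusY j) := by
  by_cases h : i = j
  · subst h
    exact Commute.refl _
  · unfold xMinusY
    exact ((site_commute _ _ h).sub_left (site_commute _ _ h)).sub_right
      ((site_commute _ _ h).sub_left (site_commute _ _ h))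

/-- The largest eigenvalue of a (Hermitian) operator. -/
def lambdaMax {n : ℕ} (A : Op n) : ℝ := sSup (spectrum ℝ A)

/-! ### Weighted graphs and the EPR Hamiltonian -/

open Classical in
/-- The edges of `G`; each undirected edge `{i, j}` is listed once, as `(i, j)` with `i < j`. -/
def edges {n : ℕ} (G : SimpleGraph (Fin n)) : Finset (Fin n × Fin n) :=
  univ.filter fun e => e.1 < e.2 ∧ G.Adj e.1 e.2

/-- The edge weights are strictly positive. -/
def PosWeight {n : ℕ} (G : SimpleGraph (Fin n)) (w : Fin n × Fin n → ℝ) : Prop :=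
  ∀ e ∈ edges G, 0 < w e

/-- `h_{ij} = (I_i I_j + X_i X_j - Y_i Y_j + Z_i Z_j) / 2`. -/
def edgeHam {n : ℕ} (i j : Fin n) : Op n :=
  (1 / 2 : ℝ) • (site .I i * site .I j + site .X i * site .X j
    - site .Y i * site .Y j + site .Z i * site .Z j)

/-- The EPR Hamiltonian `H(G) = ∑_{(i,j) ∈ E} w_{ij} h_{ij}`. -/
def eprHam {n : ℕ} (G : SimpleGraph (Fin n)) (w : Fin n × Fin n → ℝ) : Op n :=
  ∑ e ∈ edges G, w e • edgeHam e.1 e.2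

/-! ### The quantum moment-SoS hierarchy -/

/-- `𝒫_k`: the Pauli monomials on `n` qubits with at most `k` non-identity factors. -/
abbrev PauliMon (n k : ℕ) : Type :=
  {p : Fin n → Pauli // (univ.filter fun i => p i ≠ Pauli.I).card ≤ k}

/-- The operator of a Pauli monomial. -/
def PauliMon.op {n k : ℕ} (A : PauliMon n k) : Op n := tensorOp fun i => (A.1 i).mat

/-- The identity, as a Pauli monomial. -/
def PauliMon.one (n k : ℕ) : PauliMon n k := ⟨fun _ => .I, by simp⟩

/-- The monomial `σ_i σ_j` (for `i ≠ j`). -/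
def PauliMon.pair {n : ℕ} (σ : Pauli) (i j : Fin n) : PauliMon n 2 :=
  ⟨fun k => if k = i ∨ k = j then σ else .I, by
    refine le_trans (Finset.card_le_card (t := {i, j}) ?_) Finset.card_le_two
    intro k hk
    by_contra hne
    simp only [mem_insert, mem_singleton] at hne
    simp [hne] at hk⟩

/-- `ℳ_k`: the real moment matrices of level `k`. -/
structure IsMoment {n k : ℕ} (Γ : Matrix (PauliMon n k) (PauliMon n k) ℝ) : Prop where
  psd : Γ.PosSemidef
  eq_of_eq : ∀ A B A' B' : PauliMon n k, A.op * B.op = A'.op * B'.op → Γ A B = Γ A' B'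
  eq_neg_of_eq_neg : ∀ A B A' B' : PauliMon n k,
    A.op * B.op = -(A'.op * B'.op) → Γ A B = -Γ A' B'
  eq_zero : ∀ A B : PauliMon n k, ¬ (A.op * B.op).IsHermitian → Γ A B = 0
  diag : ∀ A : PauliMon n k, Γ A A = 1

/-- The pseudo-expectation `L(C)` of a monomial `C = C · I`. -/
def pseudoExp {n k : ℕ} (Γ : Matrix (PauliMon n k) (PauliMon n k) ℝ) (C : PauliMon n k) : ℝ :=
  Γ C (PauliMon.one n k)

/-- The level-`2` objective `L(H(G))`, expanded by linearity of `L`. -/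
def sdpObjective {n : ℕ} (G : SimpleGraph (Fin n)) (w : Fin n × Fin n → ℝ)
    (Γ : Matrix (PauliMon n 2) (PauliMon n 2) ℝ) : ℝ :=
  ∑ e ∈ edges G, w e * ((1 / 2) * (pseudoExp Γ (.one n 2) + pseudoExp Γ (.pair .X e.1 e.2)
    - pseudoExp Γ (.pair .Y e.1 e.2) + pseudoExp Γ (.pair .Z e.1 e.2)))

/-- `Γ` is an optimal solution of the level-`2` moment-SoS program of `(G, w)`. -/
def IsSDPSolution {n : ℕ} (G : SimpleGraph (Fin n)) (w : Fin n × Fin n → ℝ)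
    (Γ : Matrix (PauliMon n 2) (PauliMon n 2) ℝ) : Prop :=
  IsMoment Γ ∧ ∀ Γ' : Matrix (PauliMon n 2) (PauliMon n 2) ℝ, IsMoment Γ' →
    sdpObjective G w Γ' ≤ sdpObjective G w Γ

/-- `g_{ij} = (-1 + L(X_i X_j) - L(Y_i Y_j) + L(Z_i Z_j)) / 2`. -/
def gval {n : ℕ} (Γ : Matrix (PauliMon n 2) (PauliMon n 2) ℝ) (i j : Fin n) : ℝ :=
  (-1 + pseudoExp Γ (.pair .X i j) - pseudoExp Γ (.pair .Y i j) + pseudoExp Γ (.pair .Z i j)) / 2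

/-- `u(G) = ∑_{(i,j) ∈ E} w_{ij} (1 + g_{ij})`. -/
def upper {n : ℕ} (G : SimpleGraph (Fin n)) (w : Fin n × Fin n → ℝ)
    (Γ : Matrix (PauliMon n 2) (PauliMon n 2) ℝ) : ℝ :=
  ∑ e ∈ edges G, w e * (1 + gval Γ e.1 e.2)

/-! ### The algorithm -/

/-- The gate `exp ((𝐢 θ / 4) (X_i - Y_i) ⊗ (X_j - Y_j))`. -/
def gate {n : ℕ} (θ : ℝ) (i j : Fin n) : Op n :=
  NormedSpace.exp ((Complex.I * (θ : ℂ) / 4) • (xMinusY i * xMinusY j))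

theorem gate_commute {n : ℕ} (θ θ' : ℝ) (i j k l : Fin n) :
    Commute (gate θ i j) (gate θ' k l) := by
  have h : Commute (xMinusY i * xMinusY j) (xMinusY k * xMinusY l) :=
    ((xMinusY_commute i k).mul_left (xMinusY_commute j k)).mul_right
      ((xMinusY_commute i l).mul_left (xMinusY_commute j l))
  exact Commute.exp ((h.smul_left _).smul_right _)

/-- The circuit `∏_{(i,j) ∈ E} exp ((𝐢 θ_{ij} / 4) (X_i - Y_i) ⊗ (X_j - Y_j))`; the gates commute. -/
def circuit {n : ℕ} (G : SimpleGraph (Fin n)) (θ : Fin n → Fin n → ℝ) : Op n :=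
  (edges G).noncommProd (fun e => gate (θ e.1 e.2) e.1 e.2)
    (fun _ _ _ _ _ => gate_commute _ _ _ _ _ _)

/-- The output state `|ψ_G⟩` of the algorithm, with angles `θ_{ij} = ν(g_{ij})`, where `g` is
computed from the solution `Γ` of the semidefinite program. -/
def outputState {n : ℕ} (ν : ℝ → ℝ) (G : SimpleGraph (Fin n))
    (Γ : Matrix (PauliMon n 2) (PauliMon n 2) ℝ) : (Fin n → Fin 2) → ℂ :=
  (circuit G fun i j => ν (gval Γ i j)).mulVec (Pi.single (fun _ => 0) 1)

/-- The energy `⟨ψ| H |ψ⟩`. -/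
def energy {n : ℕ} (H : Op n) (ψ : (Fin n → Fin 2) → ℂ) : ℝ :=
  (dotProduct (star ψ) (H.mulVec ψ)).re

/-- The algorithm run with the angle function `ν` is an `α`-approximation for the EPR problem: on
every weighted graph its first step has a solution, and for every solution that this step may
return, the energy of the output state is at least `α` times, and at most, the largest eigenvalue
of the EPR Hamiltonian. -/
def IsApproximation (ν : ℝ → ℝ) (α : ℝ) : Prop :=
  ∀ (n : ℕ) (G : SimpleGraph (Fin n)) (w : Fin n × Fin n → ℝ), PosWeight G w →
    (∃ Γ, IsSDPSolution G w Γ) ∧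
    ∀ Γ, IsSDPSolution G w Γ →
      α * lambdaMax (eprHam G w) ≤ energy (eprHam G w) (outputState ν G Γ) ∧
      energy (eprHam G w) (outputState ν G Γ) ≤ lambdaMax (eprHam G w)

open Classical in
/-- `A_{ij} = ∏_{k ∈ N(i) ∖ {j}} cos ν(g_{ik})`. -/
def Acoef {n : ℕ} (ν : ℝ → ℝ) (G : SimpleGraph (Fin n))
    (Γ : Matrix (PauliMon n 2) (PauliMon n 2) ℝ) (i j : Fin n) : ℝ :=
  ∏ k ∈ univ.filter (fun k => G.Adj i k ∧ k ≠ j), Real.cos (ν (gval Γ i k))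

/-- `ℓ(G) = ∑_{(i,j) ∈ E} w_{ij} (1 + A_{ij} A_{ji} + (A_{ij} + A_{ji}) sin ν(g_{ij})) / 2`. -/
def lower {n : ℕ} (ν : ℝ → ℝ) (G : SimpleGraph (Fin n)) (w : Fin n × Fin n → ℝ)
    (Γ : Matrix (PauliMon n 2) (PauliMon n 2) ℝ) : ℝ :=
  ∑ e ∈ edges G, w e * ((1 + Acoef ν G Γ e.1 e.2 * Acoef ν G Γ e.2 e.1
    + (Acoef ν G Γ e.1 e.2 + Acoef ν G Γ e.2 e.1) * Real.sin (ν (gval Γ e.1 e.2))) / 2)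

/-- `α = inf_G ℓ(G) / u(G)`, over all weighted graphs with at least one edge (and all solutions of
the semidefinite program). -/
def ratio (ν : ℝ → ℝ) : ℝ :=
  sInf {ρ : ℝ | ∃ (n : ℕ) (G : SimpleGraph (Fin n)) (w : Fin n × Fin n → ℝ)
    (Γ : Matrix (PauliMon n 2) (PauliMon n 2) ℝ), PosWeight G w ∧ (edges G).Nonempty ∧
      IsSDPSolution G w Γ ∧ ρ = lower ν G w Γ / upper G w Γ}

/-! ### The parameter functions -/

/-- `R(x) = (√(3 (1 - x²)) - x) / 2`. -/
def R (x : ℝ) : ℝ := (Real.sqrt (3 * (1 - x ^ 2)) - x) / 2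

/-- `Q(x)` is `1 - x` on `[0, 1/2]`, `R(x)` on `(1/2, √3/2]` and `0` on `(√3/2, 1]`. -/
def Q (x : ℝ) : ℝ :=
  if x ≤ 1 / 2 then 1 - x else if x ≤ Real.sqrt 3 / 2 then R x else 0

/-- `x⁺ = max {x, 0}`. -/
def pos (x : ℝ) : ℝ := max x 0

/-- The class `𝒞` of functions `Θ : [0,1] → [0,1]`. Only the values on `[0,1]` matter. -/
structure ThetaClass (Θ : ℝ → ℝ) : Prop where
  mapsTo : Set.MapsTo Θ (Set.Icc 0 1) (Set.Icc 0 1)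
  mono : MonotoneOn Θ (Set.Icc 0 1)
  zero : Θ 0 = 0
  prod_ge : ∀ (p : ℕ) (x : Fin p → ℝ), (∀ i, x i ∈ Set.Icc (0 : ℝ) 1) → ∑ i, x i ≤ 1 →
    1 - Θ (∑ i, x i) ≤ ∏ i, (1 - Θ (x i))

/-- `f(x, y) = √((1 - Λ(y⁺)) (1 - Θ(Q(y⁺) - x⁺)))`. -/
def f (Θ Λ : ℝ → ℝ) (x y : ℝ) : ℝ :=
  Real.sqrt ((1 - Λ (pos y)) * (1 - Θ (Q (pos y) - pos x)))

/-- `f*(x) = f(x, R(x))`. -/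
def fStar (Θ Λ : ℝ → ℝ) (x : ℝ) : ℝ := f Θ Λ x (R x)

/-- The class `𝒟_{Θ,β}` of functions `Λ : [0,1] → [0,1]`. Only the values on `[0,1]` matter. -/
structure LambdaClass (Θ : ℝ → ℝ) (β : ℝ) (Λ : ℝ → ℝ) : Prop where
  mapsTo : Set.MapsTo Λ (Set.Icc 0 1) (Set.Icc 0 1)
  fStar_le : ∀ x y : ℝ, -1 ≤ x → x ≤ R β → β ≤ y → y ≤ R x → fStar Θ Λ x ≤ f Θ Λ x y

/-- The two-piece angle function: `ν(x) = arcsin √Θ(x⁺)` for `x ≤ β` and `arcsin √Λ(x⁺)` for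
`x > β`. -/
def nu (β : ℝ) (Θ Λ : ℝ → ℝ) (x : ℝ) : ℝ :=
  Real.arcsin (Real.sqrt (if x ≤ β then Θ (pos x) else Λ (pos x)))

def r1 (Θ : ℝ → ℝ) (g : ℝ) : ℝ :=
  (2 - Θ (Q (pos g)) + 2 * Real.sqrt (Θ (pos g) * (1 - Θ (Q (pos g))))) / (2 * (1 + g))

def r2 (Θ Λ : ℝ → ℝ) (g : ℝ) : ℝ :=
  (2 - Θ (Q (pos g)) + 2 * Real.sqrt (Λ (pos g) * (1 - Θ (Q (pos g))))) / (2 * (1 + g))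

def r3 (Θ Λ : ℝ → ℝ) (g : ℝ) : ℝ :=
  (1 + fStar Θ Λ g ^ 2 + 2 * Real.sqrt (Θ (pos g)) * fStar Θ Λ g) / (2 * (1 + g))

/-- The minimum of `min_{0 ≤ g ≤ β} r₁`, `min_{β ≤ g ≤ 1} r₂` and `min_{-1 < g ≤ R(β)} r₃`, where
the inner minima are infima (nothing forces them to be attained). -/
def minBound (β : ℝ) (Θ Λ : ℝ → ℝ) : ℝ :=
  min (sInf (r1 Θ '' Set.Icc 0 β))
    (min (sInf (r2 Θ Λ '' Set.Icc β 1)) (sInf (r3 Θ Λ '' Set.Ioc (-1) (R β))))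

end

end EPR

namespace EPR

noncomputable section

open Finset

/-! ### Pauli algebra -/

/-! The output energy is compared with `λmax` through `ℓ(G)` and `u(G)`, and `ℓ` is compared with
`u` edge by edge.

Upper side: the moment matrix of a top eigenvector is feasible, so `λmax ≤ u(G)`
(`lambdaMax_le_upper`). The feasible set is compact, so an optimal solution exists.

Lower side: all gates are diagonal in the product basis of eigenvectors of the operators `X_i -
Y_i`, in which `|0…0⟩` is an equal-weight sum. Since `X_i + Y_i` and `Z_i` only flip the sign at
`i`, every correlation is an average of phases over independent signs. This gives the exact edge
energy (`energy_edgeHam_circuit`), and `two_mul_prod_le` bounds its `ZZ` part below by `A_{ij}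
A_{ji}`. Hence the energy is at least `ℓ(G)`.

Monogamy: the operators `h_{ij} - 1` are reflections, with unit Gram vectors. The inner product of
two that share a vertex is explicit up to a swap expectation, which is at most one. Cauchy-Schwarz
then yields `∑_k g_{ik} ≤ 1` on a star, `g_{ik} ≤ R(g_{ij})` on a triangle, and a mixed bound for a
star with a distinguished edge. Together these say that the other edges at a vertex carry positive
part at most `Q(g_{ij}⁺)` (`sum_pos_gval_le_Q`).

Edge bound: the product condition on `Θ` turns this budget into `A_{ij} ≥ √(1 - Θ(Q(g⁺)))` when no
other edge at `i` exceeds `β`. If one does, the triangle bound makes it the only one, and the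
condition on `Λ` gives `A_{ij} ≥ f*(g_{ij})`. Putting the smaller bound at the two endpoints into
the edge term produces `r1`, `r2` or `r3` (`minBound_mul_le_edge`). Summing over the edges gives
`minBound ≤ ratio`. -/

theorem Pauli.mat_mul_self (σ : Pauli) : σ.mat * σ.mat = 1 := by
  cases σ <;> ext i j <;> fin_cases i <;> fin_cases j <;>
    simp [Pauli.mat, Matrix.mul_apply, Fin.sum_univ_two]

theorem Pauli.mat_isHermitian (σ : Pauli) : σ.mat.IsHermitian := by
  cases σ <;> ext i j <;> fin_cases i <;> fin_cases j <;> simp [Pauli.mat]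

/-- The sign `ε` in the commutation rule `τ σ = ε σ τ` of Pauli matrices. -/
def Pauli.sign (σ τ : Pauli) : ℂ :=
  if σ = .I ∨ τ = .I ∨ σ = τ then 1 else -1

theorem Pauli.sign_eq (σ τ : Pauli) : Pauli.sign σ τ = 1 ∨ Pauli.sign σ τ = -1 := by
  unfold Pauli.sign; split_ifs <;> simp

theorem Pauli.mat_mul_comm (σ τ : Pauli) : τ.mat * σ.mat = σ.sign τ • (σ.mat * τ.mat) := by
  cases σ <;> cases τ <;> ext i j <;> fin_cases i <;> fin_cases j <;>
    simp [Pauli.mat, Pauli.sign, Matrix.mul_apply, Fin.sum_univ_two]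

theorem tensorOp_smul {n : ℕ} (c : Fin n → ℂ) (A : Fin n → Matrix (Fin 2) (Fin 2) ℂ) :
    tensorOp (fun k => c k • A k) = (∏ k, c k) • tensorOp A := by
  ext s t
  simp [tensorOp, Finset.prod_mul_distrib]

theorem tensorOp_one {n : ℕ} : tensorOp (fun _ : Fin n => 1) = 1 := by
  ext s t
  simp only [tensorOp, Matrix.of_apply, Matrix.one_apply, Finset.prod_ite_zero, funext_iff,
    Finset.mem_univ, true_imp_iff, Finset.prod_const_one]

theorem tensorOp_conjTranspose {n : ℕ} (A : Fin n → Matrix (Fin 2) (Fin 2) ℂ) :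
    (tensorOp A).conjTranspose = tensorOp fun k => (A k).conjTranspose := by
  ext s t
  simp [tensorOp, Matrix.conjTranspose_apply]

namespace PauliMon

variable {n k : ℕ}

theorem op_isHermitian (A : PauliMon n k) : A.op.IsHermitian := by
  unfold Matrix.IsHermitian op
  rw [tensorOp_conjTranspose]
  congr 1; funext i
  exact (A.1 i).mat_isHermitian

theorem op_mul_self (A : PauliMon n k) : A.op * A.op = 1 := by
  unfold op
  rw [tensorOp_mul, ← tensorOp_one]
  congr 1; funext i
  exact (A.1 i).mat_mul_self

theorem op_one : (one n k).op = 1 := by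
  unfold op one
  rw [← tensorOp_one]
  rfl

theorem op_mul_comm (A B : PauliMon n k) :
    B.op * A.op = (∏ i, (A.1 i).sign (B.1 i)) • (A.op * B.op) := by
  unfold op
  rw [tensorOp_mul, tensorOp_mul, ← tensorOp_smul]
  congr 1; funext i
  exact (A.1 i).mat_mul_comm (B.1 i)

theorem prod_sign_eq (A B : PauliMon n k) :
    (∏ i, (A.1 i).sign (B.1 i)) = 1 ∨ (∏ i, (A.1 i).sign (B.1 i)) = -1 := by
  refine Finset.prod_induction _ (fun c : ℂ => c = 1 ∨ c = -1) ?_ (Or.inl rfl)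
    (fun i _ => Pauli.sign_eq _ _)
  rintro a b (rfl | rfl) (rfl | rfl) <;> simp

theorem conjTranspose_op_mul (A B : PauliMon n k) :
    (A.op * B.op).conjTranspose = B.op * A.op := by
  rw [Matrix.conjTranspose_mul, A.op_isHermitian, B.op_isHermitian]

/-- If the factors anticommute, a Hermitian product equals its own negative and vanishes, yet it is
a product of involutions. -/
theorem op_mul_not_isHermitian {A B : PauliMon n k}
    (h : (∏ i, (A.1 i).sign (B.1 i)) = -1) : ¬ (A.op * B.op).IsHermitian := by
  intro hH
  have h1 : B.op * A.op = A.op * B.op := by rw [← conjTranspose_op_mul]; exact hH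
  have h2 := op_mul_comm A B
  rw [h, h1, neg_smul, one_smul] at h2
  have h3 : A.op * B.op = 0 := by
    ext s t
    exact self_eq_neg.mp (congrFun (congrFun h2 s) t)
  have h4 : A.op * B.op * (B.op * A.op) = 1 := by
    rw [← mul_assoc, mul_assoc A.op, op_mul_self, mul_one, op_mul_self]
  rw [h3, zero_mul] at h4
  exact zero_ne_one h4

theorem conjTranspose_op_mul_of_not_isHermitian {A B : PauliMon n k}
    (h : ¬ (A.op * B.op).IsHermitian) :
    (A.op * B.op).conjTranspose = -(A.op * B.op) := by
  rcases prod_sign_eq A B with h1 | h1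
  · refine absurd ?_ h
    unfold Matrix.IsHermitian
    rw [conjTranspose_op_mul, op_mul_comm, h1, one_smul]
  · rw [conjTranspose_op_mul, op_mul_comm, h1, neg_smul, one_smul]

end PauliMon

/-! ### The largest eigenvalue -/

open scoped ComplexOrder in
theorem energy_le_lambdaMax {n : ℕ} {A : Op n} (hA : A.IsHermitian)
    {ψ : (Fin n → Fin 2) → ℂ} (hψ : dotProduct (star ψ) ψ = 1) :
    energy A ψ ≤ lambdaMax A := by
  -- No point of the spectrum exceeds its supremum, so `λmax · 1 - A` is positive semidefinite; its
  -- expectation in `ψ` is the claim.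
  have hB : (algebraMap ℝ (Op n) (lambdaMax A) - A).PosSemidef := by
    rw [Matrix.posSemidef_iff_isHermitian_and_spectrum_nonneg]
    have hs : (algebraMap ℝ (Op n) (lambdaMax A) - A).IsHermitian := by
      refine Matrix.IsHermitian.sub ?_ hA
      rw [Algebra.algebraMap_eq_smul_one]
      exact (Matrix.isHermitian_one).smul (IsSelfAdjoint.all _)
    refine ⟨hs, ?_⟩
    intro z hz
    obtain ⟨r, hr, rfl⟩ : ∃ r : ℝ, r ∈ spectrum ℝ (algebraMap ℝ (Op n) (lambdaMax A) - A) ∧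
        (r : ℂ) = z := by
      rw [hs.spectrum_eq_image_range] at hz
      obtain ⟨_, ⟨i, rfl⟩, rfl⟩ := hz
      exact ⟨_, hs.eigenvalues_mem_spectrum_real i, rfl⟩
    rw [← spectrum.singleton_sub_eq] at hr
    obtain ⟨x, hx, y, hy, rfl⟩ := Set.mem_sub.mp hr
    rw [Set.mem_singleton_iff] at hx
    subst hx
    have : y ≤ lambdaMax A := le_csSup Matrix.finite_real_spectrum.bddAbove hy
    simpa using this
  have h := hB.re_dotProduct_nonneg ψ
  rw [Matrix.sub_mulVec, dotProduct_sub, Algebra.algebraMap_eq_smul_one, Matrix.smul_mulVec,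
    Matrix.one_mulVec, dotProduct_smul, hψ] at h
  simp only [map_sub, sub_nonneg] at h
  simpa [energy] using h

theorem exists_energy_eq_lambdaMax {n : ℕ} {A : Op n} (hA : A.IsHermitian) :
    ∃ ψ : (Fin n → Fin 2) → ℂ, dotProduct (star ψ) ψ = 1 ∧ energy A ψ = lambdaMax A := by
  have hne : (spectrum ℝ A).Nonempty := by
    rw [hA.spectrum_real_eq_range_eigenvalues]; exact Set.range_nonempty _
  have hmem : lambdaMax A ∈ spectrum ℝ A := hne.csSup_mem Matrix.finite_real_spectrum
  rw [hA.spectrum_real_eq_range_eigenvalues] at hmem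
  obtain ⟨i, hi⟩ := hmem
  refine ⟨(hA.eigenvectorBasis i).ofLp, ?_, ?_⟩
  · have := hA.eigenvectorBasis.orthonormal.1 i
    have h2 : inner ℂ (hA.eigenvectorBasis i) (hA.eigenvectorBasis i) = (1 : ℂ) := by
      rw [inner_self_eq_norm_sq_to_K, this]; simp
    rw [EuclideanSpace.inner_eq_star_dotProduct, dotProduct_comm] at h2
    exact h2
  · rw [← hi, hA.eigenvalues_eq]; rfl

/-! ### Linearity of the energy -/

section energy

variable {n : ℕ} (ψ : (Fin n → Fin 2) → ℂ)

theorem energy_add (A B : Op n) : energy (A + B) ψ = energy A ψ + energy B ψ := by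
  simp [energy, Matrix.add_mulVec]

theorem energy_sub (A B : Op n) : energy (A - B) ψ = energy A ψ - energy B ψ := by
  simp [energy, Matrix.sub_mulVec]

theorem energy_smul (c : ℝ) (A : Op n) : energy (c • A) ψ = c * energy A ψ := by
  simp [energy, Matrix.smul_mulVec]

theorem energy_sum {ι : Type*} (s : Finset ι) (A : ι → Op n) :
    energy (∑ i ∈ s, A i) ψ = ∑ i ∈ s, energy (A i) ψ := by
  classical
  induction s using Finset.induction_on with
  | empty => simp [energy]
  | insert a s ha ih => rw [Finset.sum_insert ha, energy_add, ih, Finset.sum_insert ha]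

end energy

/-! ### Sites and pairs -/

theorem site_I {n : ℕ} (i : Fin n) : site .I i = 1 := by
  unfold site
  rw [← tensorOp_one]
  congr 1; funext k
  simp [Pauli.mat]

theorem PauliMon.op_pair {n : ℕ} (σ : Pauli) {i j : Fin n} (h : i ≠ j) :
    (PauliMon.pair σ i j).op = site σ i * site σ j := by
  unfold PauliMon.op site
  rw [tensorOp_mul]
  congr 1; funext k
  by_cases hi : k = i
  · subst hi; simp [PauliMon.pair, h]
  · by_cases hj : k = j
    · subst hj; simp [PauliMon.pair, hi]
    · simp [PauliMon.pair, hi, hj, Pauli.mat]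

theorem PauliMon.pair_comm {n : ℕ} (σ : Pauli) (i j : Fin n) :
    PauliMon.pair σ i j = PauliMon.pair σ j i := by
  apply Subtype.ext
  funext k
  simp [PauliMon.pair, or_comm]

theorem edgeHam_isHermitian {n : ℕ} {i j : Fin n} (h : i ≠ j) : (edgeHam i j).IsHermitian := by
  have hp : ∀ σ : Pauli, (site σ i * site σ j).IsHermitian := fun σ => by
    rw [← PauliMon.op_pair σ h]; exact PauliMon.op_isHermitian _
  unfold edgeHam
  exact ((((hp _).add (hp _)).sub (hp _)).add (hp _)).smul (IsSelfAdjoint.all _)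

theorem mem_edges {n : ℕ} {G : SimpleGraph (Fin n)} {e : Fin n × Fin n} :
    e ∈ edges G ↔ e.1 < e.2 ∧ G.Adj e.1 e.2 := by
  simp [edges]

theorem eprHam_isHermitian {n : ℕ} (G : SimpleGraph (Fin n)) (w : Fin n × Fin n → ℝ) :
    (eprHam G w).IsHermitian := by
  unfold eprHam
  refine Finset.sum_induction _ Matrix.IsHermitian (fun _ _ => Matrix.IsHermitian.add)
    Matrix.isHermitian_zero fun e he => ?_
  exact (edgeHam_isHermitian (mem_edges.mp he).1.ne).smul (IsSelfAdjoint.all _)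

/-! ### Moment matrices of states -/

/-- The moment matrix of the state `ψ`. -/
def stateMoment {n : ℕ} (k : ℕ) (ψ : (Fin n → Fin 2) → ℂ) :
    Matrix (PauliMon n k) (PauliMon n k) ℝ :=
  Matrix.of fun A B => energy (A.op * B.op) ψ

theorem energy_neg {n : ℕ} (ψ : (Fin n → Fin 2) → ℂ) (A : Op n) :
    energy (-A) ψ = -energy A ψ := by
  simp [energy, Matrix.neg_mulVec]

theorem energy_conjTranspose {n : ℕ} (ψ : (Fin n → Fin 2) → ℂ) (A : Op n) :
    energy A.conjTranspose ψ = energy A ψ := by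
  unfold energy
  rw [Matrix.dotProduct_mulVec, ← Matrix.star_mulVec, Matrix.star_dotProduct]
  simp

theorem stateMoment_posSemidef {n k : ℕ} (ψ : (Fin n → Fin 2) → ℂ) :
    (stateMoment k ψ).PosSemidef := by
  -- The entries are real parts of complex inner products of the vectors `A.op ψ`, that is, real
  -- inner products of their real and imaginary parts.
  let M₁ : Matrix (Fin n → Fin 2) (PauliMon n k) ℝ := Matrix.of fun s A => (A.op.mulVec ψ s).re
  let M₂ : Matrix (Fin n → Fin 2) (PauliMon n k) ℝ := Matrix.of fun s A => (A.op.mulVec ψ s).im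
  have h : stateMoment k ψ = M₁.conjTranspose * M₁ + M₂.conjTranspose * M₂ := by
    ext A B
    have h1 : dotProduct (star ψ) ((A.op * B.op).mulVec ψ) =
        dotProduct (star (A.op.mulVec ψ)) (B.op.mulVec ψ) := by
      rw [Matrix.star_mulVec, A.op_isHermitian, ← Matrix.dotProduct_mulVec, Matrix.mulVec_mulVec]
    simp only [stateMoment, energy, Matrix.of_apply]
    rw [h1]
    simp only [Matrix.of_apply, M₁, M₂, Matrix.add_apply,
      Matrix.mul_apply, Matrix.conjTranspose_apply, dotProduct, Complex.re_sum, Pi.star_apply,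
      ← Finset.sum_add_distrib]
    refine Finset.sum_congr rfl fun s _ => ?_
    simp
  rw [h]
  exact (Matrix.posSemidef_conjTranspose_mul_self _).add
    (Matrix.posSemidef_conjTranspose_mul_self _)

/-- For the vanishing entries: a non-Hermitian product of Paulis is anti-Hermitian, and `energy`,
being a real part, is invariant under conjugate transposition. -/
theorem stateMoment_isMoment {n k : ℕ} {ψ : (Fin n → Fin 2) → ℂ}
    (hψ : dotProduct (star ψ) ψ = 1) : IsMoment (stateMoment k ψ) where
  psd := stateMoment_posSemidef ψ
  eq_of_eq A B A' B' h := by simp [stateMoment, h]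
  eq_neg_of_eq_neg A B A' B' h := by simp [stateMoment, h, energy_neg]
  eq_zero A B h := by
    have h1 := energy_conjTranspose ψ (A.op * B.op)
    rw [PauliMon.conjTranspose_op_mul_of_not_isHermitian h, energy_neg] at h1
    exact self_eq_neg.mp h1.symm
  diag A := by simp [stateMoment, PauliMon.op_mul_self, energy, hψ]

theorem pseudoExp_one {n k : ℕ} {Γ : Matrix (PauliMon n k) (PauliMon n k) ℝ} (hΓ : IsMoment Γ) :
    pseudoExp Γ (.one n k) = 1 := hΓ.diag _

theorem energy_eprHam {n : ℕ} (G : SimpleGraph (Fin n)) (w : Fin n × Fin n → ℝ)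
    (ψ : (Fin n → Fin 2) → ℂ) :
    energy (eprHam G w) ψ = sdpObjective G w (stateMoment 2 ψ) := by
  unfold eprHam sdpObjective
  rw [energy_sum]
  refine Finset.sum_congr rfl fun e he => ?_
  have hne := (mem_edges.mp he).1.ne
  simp only [energy_smul, edgeHam, energy_add, energy_sub, pseudoExp, stateMoment,
    Matrix.of_apply, PauliMon.op_one, mul_one, PauliMon.op_pair _ hne, site_I]

theorem sdpObjective_eq_upper {n : ℕ} (G : SimpleGraph (Fin n)) (w : Fin n × Fin n → ℝ)
    {Γ : Matrix (PauliMon n 2) (PauliMon n 2) ℝ} (hΓ : IsMoment Γ) :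
    sdpObjective G w Γ = upper G w Γ := by
  unfold sdpObjective upper gval
  rw [pseudoExp_one hΓ]
  exact Finset.sum_congr rfl fun e _ => by ring

theorem lambdaMax_le_upper {n : ℕ} {G : SimpleGraph (Fin n)} {w : Fin n × Fin n → ℝ}
    {Γ : Matrix (PauliMon n 2) (PauliMon n 2) ℝ} (hΓ : IsSDPSolution G w Γ) :
    lambdaMax (eprHam G w) ≤ upper G w Γ := by
  obtain ⟨ψ, hψ, h⟩ := exists_energy_eq_lambdaMax (eprHam_isHermitian G w)
  rw [← h, energy_eprHam, ← sdpObjective_eq_upper G w hΓ.1]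
  exact hΓ.2 _ (stateMoment_isMoment hψ)

/-! ### Solutions of the semidefinite program -/

theorem isClosed_isMoment (n k : ℕ) :
    IsClosed {Γ : Matrix (PauliMon n k) (PauliMon n k) ℝ | IsMoment Γ} := by
  have h : {Γ : Matrix (PauliMon n k) (PauliMon n k) ℝ | IsMoment Γ} =
      {Γ | Γ.conjTranspose = Γ} ∩
      (⋂ x : PauliMon n k → ℝ, {Γ | 0 ≤ dotProduct (star x) (Γ.mulVec x)}) ∩
      (⋂ (A) (B) (A') (B') (_ : A.op * B.op = A'.op * B'.op), {Γ | Γ A B = Γ A' B'}) ∩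
      (⋂ (A) (B) (A') (B') (_ : A.op * B.op = -(A'.op * B'.op)), {Γ | Γ A B = -Γ A' B'}) ∩
      (⋂ (A) (B) (_ : ¬ (A.op * B.op).IsHermitian), {Γ | Γ A B = 0}) ∩ (⋂ A, {Γ | Γ A A = 1}) := by
    ext Γ
    simp only [Set.mem_inter_iff, Set.mem_iInter, Set.mem_ofPred_eq]
    constructor
    · rintro ⟨h1, h2, h3, h4, h5⟩
      rw [Matrix.posSemidef_iff_dotProduct_mulVec] at h1
      exact ⟨⟨⟨⟨⟨h1.1, h1.2⟩, h2⟩, h3⟩, h4⟩, h5⟩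
    · rintro ⟨⟨⟨⟨⟨h1, h1'⟩, h2⟩, h3⟩, h4⟩, h5⟩
      exact ⟨Matrix.posSemidef_iff_dotProduct_mulVec.mpr ⟨h1, h1'⟩, h2, h3, h4, h5⟩
  have hc : ∀ A B, Continuous fun Γ : Matrix (PauliMon n k) (PauliMon n k) ℝ => Γ A B :=
    fun A B => continuous_id.matrix_elem A B
  rw [h]
  refine (((((isClosed_eq continuous_id.matrix_conjTranspose continuous_id).inter
    (isClosed_iInter fun x => isClosed_le continuous_const ?_)).inter
      ?_).inter ?_).inter ?_).inter ?_
  · exact continuous_const.dotProduct (continuous_id.matrix_mulVec continuous_const)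
  · exact isClosed_iInter fun A => isClosed_iInter fun B => isClosed_iInter fun A' =>
      isClosed_iInter fun B' => isClosed_iInter fun _ => isClosed_eq (hc _ _) (hc _ _)
  · exact isClosed_iInter fun A => isClosed_iInter fun B => isClosed_iInter fun A' =>
      isClosed_iInter fun B' => isClosed_iInter fun _ => isClosed_eq (hc _ _) (hc _ _).neg
  · exact isClosed_iInter fun A => isClosed_iInter fun B => isClosed_iInter fun _ =>
      isClosed_eq (hc _ _) continuous_const
  · exact isClosed_iInter fun A => isClosed_eq (hc _ _) continuous_const

open scoped MatrixOrder Matrix.Norms.L2Operator in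
/-- A Gram representation of a moment matrix. -/
theorem IsMoment.exists_gram {n k : ℕ} {Γ : Matrix (PauliMon n k) (PauliMon n k) ℝ}
    (hΓ : IsMoment Γ) :
    ∃ u : PauliMon n k → EuclideanSpace ℝ (PauliMon n k), ∀ A B, inner ℝ (u A) (u B) = Γ A B := by
  classical
  obtain ⟨M, hM⟩ := CStarAlgebra.nonneg_iff_eq_star_mul_self.mp
    (Matrix.PosSemidef.nonneg hΓ.psd)
  refine ⟨fun A => WithLp.toLp 2 fun C => M C A, fun A B => ?_⟩
  rw [hM, EuclideanSpace.inner_eq_star_dotProduct]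
  simp [dotProduct, Matrix.mul_apply, mul_comm]

theorem IsMoment.abs_le_one {n k : ℕ} {Γ : Matrix (PauliMon n k) (PauliMon n k) ℝ}
    (hΓ : IsMoment Γ) (A B : PauliMon n k) : |Γ A B| ≤ 1 := by
  obtain ⟨u, hu⟩ := hΓ.exists_gram
  have h1 : ∀ C, ‖u C‖ = 1 := fun C => by
    have := hu C C
    rw [hΓ.diag, real_inner_self_eq_norm_sq] at this
    nlinarith [norm_nonneg (u C)]
  have := abs_real_inner_le_norm (u A) (u B)
  rwa [hu, h1, h1, mul_one] at this

/-- The unit diagonal makes the Gram vectors unit vectors, so the closed feasible set lies in a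
cube. -/
theorem isCompact_isMoment (n k : ℕ) :
    IsCompact {Γ : Matrix (PauliMon n k) (PauliMon n k) ℝ | IsMoment Γ} := by
  refine IsCompact.of_isClosed_subset (s := (Set.univ : Set (PauliMon n k)).pi
    fun _ => (Set.univ : Set (PauliMon n k)).pi fun _ => Set.Icc (-1 : ℝ) 1)
    (isCompact_univ_pi fun _ => isCompact_univ_pi fun _ => isCompact_Icc)
    (isClosed_isMoment n k) fun Γ hΓ A _ B _ => ?_
  exact abs_le.mp (IsMoment.abs_le_one hΓ A B)

/-- The computational basis state `|0…0⟩`. -/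
def zeroState (n : ℕ) : (Fin n → Fin 2) → ℂ := Pi.single (fun _ => 0) 1

theorem zeroState_norm (n : ℕ) : dotProduct (star (zeroState n)) (zeroState n) = 1 := by
  simp [zeroState, Pi.star_single]

theorem exists_isSDPSolution {n : ℕ} (G : SimpleGraph (Fin n)) (w : Fin n × Fin n → ℝ) :
    ∃ Γ, IsSDPSolution G w Γ := by
  obtain ⟨Γ, h1, h2⟩ := (isCompact_isMoment n 2).exists_isMaxOn
    ⟨_, stateMoment_isMoment (zeroState_norm n)⟩ (f := sdpObjective G w) (by
      unfold sdpObjective pseudoExp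
      have hc : ∀ A B, Continuous fun Γ : Matrix (PauliMon n 2) (PauliMon n 2) ℝ => Γ A B :=
        fun A B => continuous_id.matrix_elem A B
      refine Continuous.continuousOn (continuous_finsetSum _ fun e _ => continuous_const.mul
        (continuous_const.mul ((((hc _ _).add (hc _ _)).sub (hc _ _)).add (hc _ _)))))
  exact ⟨Γ, h1, fun Γ' hΓ' => h2 hΓ'⟩

theorem energy_edgeHam_zeroState {n : ℕ} {i j : Fin n} (h : i ≠ j) :
    energy (edgeHam i j) (zeroState n) = 1 := by
  have hd : ∀ A : Op n, energy A (zeroState n) = (A (fun _ => 0) fun _ => 0).re := fun A => by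
    simp [energy, zeroState, Pi.star_single]
  have hp : ∀ σ : Pauli, energy (site σ i * site σ j) (zeroState n) =
      (∏ k : Fin n, if k = i ∨ k = j then σ.mat 0 0 else 1).re := fun σ => by
    rw [hd, ← PauliMon.op_pair σ h]
    simp only [PauliMon.op, tensorOp, Matrix.of_apply, PauliMon.pair]
    congr 2; funext k
    split_ifs <;> simp [Pauli.mat]
  have h0 : ∏ k : Fin n, (if k = i ∨ k = j then (0 : ℂ) else 1) = 0 :=
    Finset.prod_eq_zero (Finset.mem_univ i) (by simp)
  simp only [edgeHam, energy_smul, energy_add, energy_sub, hp]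
  simp [Pauli.mat, h0]
  norm_num

/-- Each edge has energy one in `|0…0⟩`. This is what later keeps `u(G)` away from zero in the
quotient `ℓ(G) / u(G)`. -/
theorem sum_weight_le_lambdaMax {n : ℕ} (G : SimpleGraph (Fin n)) (w : Fin n × Fin n → ℝ) :
    ∑ e ∈ edges G, w e ≤ lambdaMax (eprHam G w) := by
  refine le_trans (le_of_eq ?_) (energy_le_lambdaMax (eprHam_isHermitian G w) (zeroState_norm n))
  rw [eprHam, energy_sum]
  refine Finset.sum_congr rfl fun e he => ?_
  rw [energy_smul, energy_edgeHam_zeroState (mem_edges.mp he).1.ne, mul_one]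

/-! ### Products of two-site monomials -/

theorem site_mul_site_same {n : ℕ} {σ τ ρ : Pauli} {c : ℂ} (h : σ.mat * τ.mat = c • ρ.mat)
    (i : Fin n) : site σ i * site τ i = c • site ρ i := by
  have h1 : (∏ k : Fin n, if k = i then c else 1) = c := by simp
  unfold site
  rw [tensorOp_mul]
  conv_rhs => rw [← h1, ← tensorOp_smul]
  congr 1; funext k
  split_ifs <;> simp [h]

/-- The scalar arises once at each of the two sites, so `c = ± i` turns into the real sign `-1`. -/
theorem PauliMon.pair_mul_pair {n : ℕ} {σ τ ρ : Pauli} {c : ℂ} (h : σ.mat * τ.mat = c • ρ.mat)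
    {i j : Fin n} (hij : i ≠ j) :
    (pair σ i j).op * (pair τ i j).op = c ^ 2 • (pair ρ i j).op := by
  rw [op_pair _ hij, op_pair _ hij, op_pair _ hij, mul_assoc, ← mul_assoc (site σ j),
    (site_commute σ τ hij.symm).eq, mul_assoc, ← mul_assoc (site σ i), site_mul_site_same h,
    site_mul_site_same h, smul_mul_smul_comm, sq]

theorem PauliMon.pair_mul_pair_same {n : ℕ} (σ : Pauli) {i j k : Fin n} (hij : i ≠ j)
    (hik : i ≠ k) (hjk : j ≠ k) :
    (pair σ i j).op * (pair σ i k).op = (pair σ j k).op := by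
  have h : site σ i * site σ i = (1 : Op n) := by
    rw [site_mul_site_same (c := 1) (ρ := .I) (by rw [Pauli.mat_mul_self]; simp [Pauli.mat]),
      site_I, one_smul]
  rw [op_pair _ hij, op_pair _ hik, op_pair _ hjk, (site_commute σ σ hij).eq, mul_assoc,
    ← mul_assoc (site σ i), h, one_mul]

/-- The two monomials act by different non-identity Paulis only at the shared vertex, so they
anticommute. -/
theorem PauliMon.pair_mul_pair_not_isHermitian {n : ℕ} {σ τ : Pauli} (hσ : σ ≠ .I)
    (hτ : τ ≠ .I) (hne : σ ≠ τ) {i j k : Fin n} (hij : i ≠ j) (hjk : j ≠ k) :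
    ¬ ((pair σ i j).op * (pair τ i k).op).IsHermitian := by
  refine op_mul_not_isHermitian ?_
  rw [Finset.prod_eq_single i]
  · simp [pair, Pauli.sign, hσ, hτ, hne]
  · intro l _ hl
    by_cases h1 : l = j
    · subst h1; simp [pair, Pauli.sign, hl, hjk]
    · simp [pair, Pauli.sign, hl, h1]
  · simp

/-! ### Gram vectors of a level-two moment matrix -/

section gram

variable {n : ℕ} {Γ : Matrix (PauliMon n 2) (PauliMon n 2) ℝ}

theorem IsMoment.symm (hΓ : IsMoment Γ) (A B : PauliMon n 2) : Γ A B = Γ B A := by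
  have := congrFun (congrFun hΓ.psd.1 B) A
  simpa using this

theorem IsMoment.one_left (hΓ : IsMoment Γ) (A : PauliMon n 2) :
    Γ (.one n 2) A = pseudoExp Γ A := hΓ.symm _ _

theorem IsMoment.pair_pair_same (hΓ : IsMoment Γ) (σ : Pauli) {i j k : Fin n} (hij : i ≠ j)
    (hik : i ≠ k) (hjk : j ≠ k) :
    Γ (.pair σ i j) (.pair σ i k) = pseudoExp Γ (.pair σ j k) :=
  hΓ.eq_of_eq _ _ _ _ (by
    rw [PauliMon.pair_mul_pair_same σ hij hik hjk, PauliMon.op_one, mul_one])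

theorem IsMoment.pair_pair_eq_zero (hΓ : IsMoment Γ) {σ τ : Pauli} (hσ : σ ≠ .I)
    (hτ : τ ≠ .I) (hne : σ ≠ τ) {i j k : Fin n} (hij : i ≠ j) (hjk : j ≠ k) :
    Γ (.pair σ i j) (.pair τ i k) = 0 :=
  hΓ.eq_zero _ _ (PauliMon.pair_mul_pair_not_isHermitian hσ hτ hne hij hjk)

theorem IsMoment.pair_pair_neg (hΓ : IsMoment Γ) {σ τ ρ : Pauli} {c : ℂ}
    (h : σ.mat * τ.mat = c • ρ.mat) (hc : c ^ 2 = -1) {i j : Fin n} (hij : i ≠ j) :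
    Γ (.pair σ i j) (.pair τ i j) = -pseudoExp Γ (.pair ρ i j) :=
  hΓ.eq_neg_of_eq_neg _ _ _ _ (by
    rw [PauliMon.pair_mul_pair h hij, hc, PauliMon.op_one, mul_one, neg_smul, one_smul])

theorem Pauli.X_mul_Y : Pauli.X.mat * Pauli.Y.mat = Complex.I • Pauli.Z.mat := by
  ext i j; fin_cases i <;> fin_cases j <;> simp [Pauli.mat, Matrix.mul_apply, Fin.sum_univ_two]

theorem Pauli.X_mul_Z : Pauli.X.mat * Pauli.Z.mat = (-Complex.I) • Pauli.Y.mat := by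
  ext i j; fin_cases i <;> fin_cases j <;> simp [Pauli.mat, Matrix.mul_apply, Fin.sum_univ_two]

theorem Pauli.Y_mul_Z : Pauli.Y.mat * Pauli.Z.mat = Complex.I • Pauli.X.mat := by
  ext i j; fin_cases i <;> fin_cases j <;> simp [Pauli.mat, Matrix.mul_apply, Fin.sum_univ_two]

variable {E : Type*} [NormedAddCommGroup E] [InnerProductSpace ℝ E]

/-- The Gram vector of the reflection `h_{ij} - 1`. -/
def edgeVec (u : PauliMon n 2 → E) (i j : Fin n) : E :=
  (1 / 2 : ℝ) • (-u (.one n 2) + u (.pair .X i j) - u (.pair .Y i j) + u (.pair .Z i j))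

/-- The Gram vector of the swap of the qubits `i` and `j`. -/
def swapVec (u : PauliMon n 2 → E) (i j : Fin n) : E :=
  (1 / 2 : ℝ) • (u (.one n 2) + u (.pair .X i j) + u (.pair .Y i j) + u (.pair .Z i j))

/-- The pseudo-expectation of the swap of the qubits `i` and `j`. -/
def swapVal (Γ : Matrix (PauliMon n 2) (PauliMon n 2) ℝ) (i j : Fin n) : ℝ :=
  (1 + pseudoExp Γ (.pair .X i j) + pseudoExp Γ (.pair .Y i j) + pseudoExp Γ (.pair .Z i j)) / 2

theorem gval_comm (Γ : Matrix (PauliMon n 2) (PauliMon n 2) ℝ) (i j : Fin n) :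
    gval Γ i j = gval Γ j i := by
  simp only [gval, PauliMon.pair_comm _ i j]

variable {u : PauliMon n 2 → E}

theorem inner_one_one (hΓ : IsMoment Γ) (hu : ∀ A B, inner ℝ (u A) (u B) = Γ A B) :
    inner ℝ (u (.one n 2)) (u (.one n 2)) = (1 : ℝ) := by
  rw [hu, hΓ.diag]

theorem inner_one_edgeVec (hΓ : IsMoment Γ) (hu : ∀ A B, inner ℝ (u A) (u B) = Γ A B)
    (i j : Fin n) : inner ℝ (u (.one n 2)) (edgeVec u i j) = gval Γ i j := by
  simp only [edgeVec, gval, inner_add_right, inner_sub_right, inner_neg_right, inner_smul_right,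
    hu, hΓ.diag, hΓ.one_left]
  ring

theorem inner_one_swapVec (hΓ : IsMoment Γ) (hu : ∀ A B, inner ℝ (u A) (u B) = Γ A B)
    (i j : Fin n) : inner ℝ (u (.one n 2)) (swapVec u i j) = swapVal Γ i j := by
  simp only [swapVec, swapVal, inner_add_right, inner_smul_right, hu, hΓ.diag, hΓ.one_left]
  ring

/-- The underlying operator squares to the identity: its cross terms `XX · YY = -ZZ` and the like
cancel against the terms containing the identity. -/
theorem inner_edgeVec_self (hΓ : IsMoment Γ) (hu : ∀ A B, inner ℝ (u A) (u B) = Γ A B)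
    {i j : Fin n} (h : i ≠ j) : inner ℝ (edgeVec u i j) (edgeVec u i j) = (1 : ℝ) := by
  have hXY := hΓ.pair_pair_neg Pauli.X_mul_Y (by simp) h
  have hXZ := hΓ.pair_pair_neg Pauli.X_mul_Z (by simp) h
  have hYZ := hΓ.pair_pair_neg Pauli.Y_mul_Z (by simp) h
  have h1 : ∀ A, Γ A (.one n 2) = pseudoExp Γ A := fun A => rfl
  simp only [edgeVec, inner_add_right, inner_sub_right, inner_neg_right, inner_smul_right,
    inner_add_left, inner_sub_left, inner_neg_left, inner_smul_left,
    hu, hΓ.diag, hΓ.one_left, hXY, hXZ, hYZ, hΓ.symm (.pair .Y i j) (.pair .X i j),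
    hΓ.symm (.pair .Z i j), h1, conj_trivial]
  ring

theorem inner_swapVec_self (hΓ : IsMoment Γ) (hu : ∀ A B, inner ℝ (u A) (u B) = Γ A B)
    {i j : Fin n} (h : i ≠ j) : inner ℝ (swapVec u i j) (swapVec u i j) = (1 : ℝ) := by
  have hXY := hΓ.pair_pair_neg Pauli.X_mul_Y (by simp) h
  have hXZ := hΓ.pair_pair_neg Pauli.X_mul_Z (by simp) h
  have hYZ := hΓ.pair_pair_neg Pauli.Y_mul_Z (by simp) h
  have h1 : ∀ A, Γ A (.one n 2) = pseudoExp Γ A := fun A => rfl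
  simp only [swapVec, inner_add_right, inner_smul_right, inner_add_left, inner_smul_left,
    hu, hΓ.diag, hΓ.one_left, hXY, hXZ, hYZ, hΓ.symm (.pair .Y i j) (.pair .X i j),
    hΓ.symm (.pair .Z i j), h1, conj_trivial]
  ring

/-- Distinct Paulis meeting at `i` contribute nothing, and equal ones cancel at `i` leaving `σ_j
σ_k`. These terms assemble into the swap of `j` and `k`. -/
theorem inner_edgeVec_edgeVec (hΓ : IsMoment Γ) (hu : ∀ A B, inner ℝ (u A) (u B) = Γ A B)
    {i j k : Fin n} (hij : i ≠ j) (hik : i ≠ k) (hjk : j ≠ k) :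
    inner ℝ (edgeVec u i j) (edgeVec u i k) =
      (swapVal Γ j k - 1 - gval Γ i j - gval Γ i k) / 2 := by
  have h0 : ∀ {σ τ : Pauli}, σ ≠ .I → τ ≠ .I → σ ≠ τ →
      Γ (.pair σ i j) (.pair τ i k) = 0 := fun hσ hτ hne =>
    hΓ.pair_pair_eq_zero hσ hτ hne hij hjk
  have h1 : ∀ A, Γ A (.one n 2) = pseudoExp Γ A := fun A => rfl
  simp only [edgeVec, inner_add_right, inner_sub_right, inner_neg_right, inner_smul_right,
    inner_add_left, inner_sub_left, inner_neg_left, inner_smul_left,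
    hu, hΓ.pair_pair_same _ hij hik hjk, hΓ.diag, hΓ.one_left, h1, conj_trivial, swapVal, gval,
    h0 (σ := .X) (τ := .Y) (by decide) (by decide) (by decide),
    h0 (σ := .X) (τ := .Z) (by decide) (by decide) (by decide),
    h0 (σ := .Y) (τ := .X) (by decide) (by decide) (by decide),
    h0 (σ := .Y) (τ := .Z) (by decide) (by decide) (by decide),
    h0 (σ := .Z) (τ := .X) (by decide) (by decide) (by decide),
    h0 (σ := .Z) (τ := .Y) (by decide) (by decide) (by decide)]
  ring

theorem inner_edgeVec_swapVec (hΓ : IsMoment Γ) (hu : ∀ A B, inner ℝ (u A) (u B) = Γ A B)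
    {i j k : Fin n} (hij : i ≠ j) (hik : i ≠ k) (hjk : j ≠ k) :
    inner ℝ (edgeVec u i j) (swapVec u j k) =
      (1 + gval Γ i j + gval Γ i k - swapVal Γ j k) / 2 := by
  have h0 : ∀ {σ τ : Pauli}, σ ≠ .I → τ ≠ .I → σ ≠ τ →
      Γ (.pair σ i j) (.pair τ j k) = 0 := fun {σ τ} hσ hτ hne => by
    rw [PauliMon.pair_comm σ i j]
    exact hΓ.pair_pair_eq_zero hσ hτ hne hij.symm hik
  have hs : ∀ σ, Γ (.pair σ i j) (.pair σ j k) = pseudoExp Γ (.pair σ i k) := fun σ => by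
    rw [PauliMon.pair_comm σ i j]
    exact hΓ.pair_pair_same σ hij.symm hjk hik
  have h1 : ∀ A, Γ A (.one n 2) = pseudoExp Γ A := fun A => rfl
  simp only [edgeVec, swapVec, inner_add_right, inner_smul_right,
    inner_add_left, inner_sub_left, inner_neg_left, inner_smul_left,
    hu, hs, hΓ.diag, hΓ.one_left, h1, conj_trivial, swapVal, gval,
    h0 (σ := .X) (τ := .Y) (by decide) (by decide) (by decide),
    h0 (σ := .X) (τ := .Z) (by decide) (by decide) (by decide),
    h0 (σ := .Y) (τ := .X) (by decide) (by decide) (by decide),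
    h0 (σ := .Y) (τ := .Z) (by decide) (by decide) (by decide),
    h0 (σ := .Z) (τ := .X) (by decide) (by decide) (by decide),
    h0 (σ := .Z) (τ := .Y) (by decide) (by decide) (by decide)]
  ring

end gram

/-! ### Monogamy inequalities -/

section monogamy

variable {n : ℕ} {Γ : Matrix (PauliMon n 2) (PauliMon n 2) ℝ}

theorem abs_gval_le_one (hΓ : IsMoment Γ) {i j : Fin n} (h : i ≠ j) : |gval Γ i j| ≤ 1 := by
  obtain ⟨u, hu⟩ := hΓ.exists_gram
  have := real_inner_mul_inner_self_le (u (.one n 2)) (edgeVec u i j)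
  rw [inner_one_edgeVec hΓ hu, inner_one_one hΓ hu, inner_edgeVec_self hΓ hu h] at this
  exact abs_le_one_iff_mul_self_le_one.mpr (by linarith)

theorem swapVal_le_one (hΓ : IsMoment Γ) {i j : Fin n} (h : i ≠ j) : swapVal Γ i j ≤ 1 := by
  obtain ⟨u, hu⟩ := hΓ.exists_gram
  have := real_inner_mul_inner_self_le (u (.one n 2)) (swapVec u i j)
  rw [inner_one_swapVec hΓ hu, inner_one_one hΓ hu, inner_swapVec_self hΓ hu h] at this
  nlinarith

/-- The squared norm of the Gram vector of a star. -/
theorem inner_sum_edgeVec_le {E : Type*} [NormedAddCommGroup E] [InnerProductSpace ℝ E]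
    {u : PauliMon n 2 → E} (hΓ : IsMoment Γ) (hu : ∀ A B, inner ℝ (u A) (u B) = Γ A B)
    {i : Fin n} {K : Finset (Fin n)} (hi : i ∉ K) :
    inner ℝ (∑ k ∈ K, edgeVec u i k) (∑ k ∈ K, edgeVec u i k) ≤
      (#K : ℝ) - (#K - 1) * ∑ k ∈ K, gval Γ i k := by
  induction K using Finset.induction_on with
  | empty => simp
  | insert a K ha ih =>
    have hia : i ≠ a := fun h => hi (by simp [h])
    have hiK : i ∉ K := fun h => hi (Finset.mem_insert_of_mem h)
    have hc : inner ℝ (edgeVec u i a) (∑ k ∈ K, edgeVec u i k) ≤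
        -((#K * gval Γ i a + ∑ k ∈ K, gval Γ i k) / 2) := by
      rw [inner_sum]
      have : -((#K * gval Γ i a + ∑ k ∈ K, gval Γ i k) / 2) =
          ∑ k ∈ K, -((gval Γ i a + gval Γ i k) / 2) := by
        rw [Finset.sum_neg_distrib, ← Finset.sum_div, Finset.sum_add_distrib, Finset.sum_const,
          nsmul_eq_mul]
      rw [this]
      refine Finset.sum_le_sum fun k hk => ?_
      have hak : a ≠ k := fun h => ha (h ▸ hk)
      rw [inner_edgeVec_edgeVec hΓ hu hia (fun h => hiK (h ▸ hk)) hak]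
      linarith [swapVal_le_one hΓ hak]
    rw [Finset.sum_insert ha, Finset.sum_insert ha, Finset.card_insert_of_notMem ha,
      inner_add_left, inner_add_right, inner_add_right, inner_edgeVec_self hΓ hu hia,
      real_inner_comm (edgeVec u i a)]
    push_cast
    linarith [ih hiK]

theorem sum_gval_le_one (hΓ : IsMoment Γ) {i : Fin n} {K : Finset (Fin n)} (hi : i ∉ K) :
    ∑ k ∈ K, gval Γ i k ≤ 1 := by
  obtain ⟨u, hu⟩ := hΓ.exists_gram
  have h := real_inner_mul_inner_self_le (u (.one n 2)) (∑ k ∈ K, edgeVec u i k)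
  have h2 := inner_sum_edgeVec_le hΓ hu hi
  rw [inner_one_one hΓ hu, inner_sum] at h
  simp only [inner_one_edgeVec hΓ hu] at h
  set x := ∑ k ∈ K, gval Γ i k
  -- Cauchy-Schwarz gives `x² ≤ d - (d - 1) x` with `d = #K`, that is `(x - 1)(x + d) ≤ 0`.
  have hd : (0 : ℝ) ≤ #K := Nat.cast_nonneg _
  by_contra! hx
  nlinarith [mul_pos (sub_pos.mpr hx) (by linarith : 0 < x + #K)]

/-- The star inequality with one distinguished leaf. -/
theorem sum_gval_sq_le (hΓ : IsMoment Γ) {i j : Fin n} (hij : i ≠ j) {K : Finset (Fin n)}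
    (hi : i ∉ K) (hj : j ∉ K)
    (hnn : 0 ≤ (#K * gval Γ i j + ∑ k ∈ K, gval Γ i k) / 2 +
      gval Γ i j * ∑ k ∈ K, gval Γ i k) :
    ((#K * gval Γ i j + ∑ k ∈ K, gval Γ i k) / 2 + gval Γ i j * ∑ k ∈ K, gval Γ i k) ^ 2 ≤
      (1 - gval Γ i j ^ 2) *
        (#K - (#K - 1) * (∑ k ∈ K, gval Γ i k) - (∑ k ∈ K, gval Γ i k) ^ 2) := by
  obtain ⟨u, hu⟩ := hΓ.exists_gram
  have h2 := inner_sum_edgeVec_le hΓ hu hi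
  have h0 : inner ℝ (u (.one n 2)) (∑ k ∈ K, edgeVec u i k) = ∑ k ∈ K, gval Γ i k := by
    rw [inner_sum]; simp only [inner_one_edgeVec hΓ hu]
  have hc : inner ℝ (edgeVec u i j) (∑ k ∈ K, edgeVec u i k) ≤
      -((#K * gval Γ i j + ∑ k ∈ K, gval Γ i k) / 2) := by
    rw [inner_sum]
    have : -((#K * gval Γ i j + ∑ k ∈ K, gval Γ i k) / 2) =
        ∑ k ∈ K, -((gval Γ i j + gval Γ i k) / 2) := by
      rw [Finset.sum_neg_distrib, ← Finset.sum_div, Finset.sum_add_distrib, Finset.sum_const,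
        nsmul_eq_mul]
    rw [this]
    refine Finset.sum_le_sum fun k hk => ?_
    have hjk : j ≠ k := fun h => hj (h ▸ hk)
    rw [inner_edgeVec_edgeVec hΓ hu hij (fun h => hi (h ▸ hk)) hjk]
    linarith [swapVal_le_one hΓ hjk]
  set x := ∑ k ∈ K, gval Γ i k
  set y := gval Γ i j with hy
  set V := ∑ k ∈ K, edgeVec u i k
  set v := edgeVec u i j with hv
  set e := u (.one n 2)
  have h1 : inner ℝ e e = (1 : ℝ) := inner_one_one hΓ hu
  have h3 : inner ℝ e v = y := inner_one_edgeVec hΓ hu i j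
  have h4 : inner ℝ v v = (1 : ℝ) := inner_edgeVec_self hΓ hu hij
  -- Cauchy-Schwarz is applied to the components orthogonal to `e`. Their inner product is at most
  -- minus the nonnegative quantity in `hnn`, so squaring is legitimate.
  have h := real_inner_mul_inner_self_le (v - y • e) (V - x • e)
  have e1 : inner ℝ (v - y • e) (V - x • e) = inner ℝ v V - x * y := by
    simp only [inner_sub_left, inner_sub_right, real_inner_smul_left, real_inner_smul_right,
      h0, h1, h3, real_inner_comm e v]
    ring
  have e2 : inner ℝ (v - y • e) (v - y • e) = 1 - y ^ 2 := by
    simp only [inner_sub_left, inner_sub_right, real_inner_smul_left, real_inner_smul_right,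
      h1, h3, h4, real_inner_comm e v]
    ring
  have e3 : inner ℝ (V - x • e) (V - x • e) = inner ℝ V V - x ^ 2 := by
    simp only [inner_sub_left, inner_sub_right, real_inner_smul_left, real_inner_smul_right,
      h0, h1, real_inner_comm e V]
    ring
  rw [e1, e2, e3] at h
  have hy1 : 0 ≤ 1 - y ^ 2 := by rw [← e2]; exact real_inner_self_nonneg
  nlinarith [mul_le_mul_of_nonneg_left h2 hy1]

/-- The hypothesis reduces to `4 F ≤ 3 (1 - t)²`, an ellipse in `(a, b)` depending on `t`. Where `2b
+ a > 0`, it lies inside the one at `t = 0`, namely `a² + ab + b² ≤ 3/4`, whose upper branch is `b =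
R a`. -/
theorem le_R_of_ellipse {a b t : ℝ} (ha : -1 ≤ a) (ht : 0 ≤ t)
    (h : 2 * ((a + t) ^ 2 + (a + t) * (b + t) + (b + t) ^ 2) *
      (2 * ((a + t) ^ 2 + (a + t) * (b + t) + (b + t) ^ 2)) ≤
      (1 - t) * (3 * ((a + t) ^ 2 + (a + t) * (b + t) + (b + t) ^ 2) * (1 - t))) :
    b ≤ R a := by
  obtain ⟨F, hF⟩ : ∃ F, F = (a + t) ^ 2 + (a + t) * (b + t) + (b + t) ^ 2 := ⟨_, rfl⟩
  rw [← hF] at h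
  have hF0 : 0 ≤ F := by
    rw [hF]; linarith [sq_nonneg (a + t + (b + t)), sq_nonneg (a + t), sq_nonneg (b + t)]
  have hF1 : 4 * F ≤ 3 * (1 - t) ^ 2 := by
    rcases hF0.eq_or_lt with h0 | h0
    · rw [← h0]; linarith [sq_nonneg (1 - t)]
    · exact le_of_mul_le_mul_left (by linarith : F * (4 * F) ≤ F * (3 * (1 - t) ^ 2)) h0
  have hs : 0 ≤ Real.sqrt (3 * (1 - a ^ 2)) := Real.sqrt_nonneg _
  unfold R
  by_cases hab : 2 * b + a ≤ 0
  · linarith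
  · push Not at hab
    have : 2 * b + a ≤ Real.sqrt (3 * (1 - a ^ 2)) := by
      apply Real.le_sqrt_of_sq_le
      -- From `2b + a > 0` and `a ≥ -1` one gets `1 + 2(a + b) > 0`; this is the part of the
      -- expansion that is linear in `t`.
      have h3 : 0 ≤ t * (6 + 12 * (a + b)) := mul_nonneg ht (by linarith)
      rw [hF] at hF1
      linarith [sq_nonneg t]
    linarith

/-- The triangle inequality: `g_{ik} ≤ R(g_{ij})`. -/
theorem gval_le_R (hΓ : IsMoment Γ) {i j k : Fin n} (hij : i ≠ j) (hik : i ≠ k) (hjk : j ≠ k) :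
    gval Γ i k ≤ R (gval Γ i j) := by
  obtain ⟨u, hu⟩ := hΓ.exists_gram
  have ha := abs_le.mp (abs_gval_le_one hΓ hij)
  set a := gval Γ i j with ha'
  set b := gval Γ i k with hb'
  set c := swapVal Γ j k with hc'
  set e := u (.one n 2)
  set A := edgeVec u i j with hA'
  set B := edgeVec u i k with hB'
  set C := swapVec u j k with hC'
  have hee : inner ℝ e e = (1 : ℝ) := inner_one_one hΓ hu
  have heA : inner ℝ e A = a := inner_one_edgeVec hΓ hu i j
  have heB : inner ℝ e B = b := inner_one_edgeVec hΓ hu i k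
  have heC : inner ℝ e C = c := inner_one_swapVec hΓ hu j k
  have hAA : inner ℝ A A = (1 : ℝ) := inner_edgeVec_self hΓ hu hij
  have hBB : inner ℝ B B = (1 : ℝ) := inner_edgeVec_self hΓ hu hik
  have hCC : inner ℝ C C = (1 : ℝ) := inner_swapVec_self hΓ hu hjk
  have hAB : inner ℝ A B = (c - 1 - a - b) / 2 := inner_edgeVec_edgeVec hΓ hu hij hik hjk
  have hAC : inner ℝ A C = (1 + a + b - c) / 2 := inner_edgeVec_swapVec hΓ hu hij hik hjk
  have hBC : inner ℝ B C = (1 + a + b - c) / 2 := by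
    have h := inner_edgeVec_swapVec hΓ hu hik hij hjk.symm
    have hs : swapVec u k j = swapVec u j k := by simp only [swapVec, PauliMon.pair_comm _ k j]
    have hs' : swapVal Γ k j = swapVal Γ j k := by simp only [swapVal, PauliMon.pair_comm _ k j]
    rw [hs, hs'] at h
    rw [h]; ring
  obtain ⟨t, ht⟩ : ∃ t, t = (c - a - b) / 3 := ⟨_, rfl⟩
  have ht0 : 0 ≤ t := by
    have h : (0 : ℝ) ≤ inner ℝ (C - A - B) (C - A - B) := real_inner_self_nonneg
    simp only [inner_sub_left, inner_sub_right, hAA, hBB, hCC, hAB, hAC, hBC,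
      real_inner_comm A B, real_inner_comm A C, real_inner_comm B C] at h
    rw [ht]; linarith
  -- Up to conjugation by `Y_i`, the operators of `-A`, `-B`, `C` are the three transpositions of
  -- qubits `i, j, k`. Their mean is the projector onto the symmetric subspace, whence `⟨e, p⟩ = ⟨p,
  -- p⟩ = t`. Off that subspace, `A + p` and `B + p` have squared norm `1 - t` and meet at an angle
  -- of 120 degrees.
  set p := (1 / 3 : ℝ) • (C - A - B) with hp
  -- Up to a common factor, these are the coefficients of the projection of `e - p` onto the span of
  -- `A + p` and `B + p`, hence the best choice in Cauchy-Schwarz.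
  set x := 2 * (a + t) + (b + t) with hx
  set y := 2 * (b + t) + (a + t) with hy
  have hcs := real_inner_mul_inner_self_le (e - p) (x • (A + p) + y • (B + p))
  set F := (a + t) ^ 2 + (a + t) * (b + t) + (b + t) ^ 2 with hF
  have e1 : inner ℝ (e - p) (x • (A + p) + y • (B + p)) = 2 * F := by
    simp only [hp, inner_add_right, inner_sub_left, inner_sub_right,
      real_inner_smul_left, real_inner_smul_right, heA, heB, heC, hAA, hBB, hCC, hAB, hAC,
      hBC, real_inner_comm A B, real_inner_comm A C, real_inner_comm B C]
    rw [hF, hx, hy, ht]; ring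
  have e2 : inner ℝ (e - p) (e - p) = 1 - t := by
    simp only [hp, inner_sub_left, inner_sub_right,
      real_inner_smul_left, real_inner_smul_right, hee, heA, heB, heC, hAA, hBB, hCC, hAB, hAC,
      hBC, real_inner_comm A B, real_inner_comm A C, real_inner_comm B C,
      real_inner_comm e A, real_inner_comm e B, real_inner_comm e C]
    rw [ht]; ring
  have e3 : inner ℝ (x • (A + p) + y • (B + p)) (x • (A + p) + y • (B + p)) =
      3 * F * (1 - t) := by
    simp only [hp, inner_add_left, inner_add_right, inner_sub_left, inner_sub_right,
      real_inner_smul_left, real_inner_smul_right, hAA, hBB, hCC, hAB, hAC,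
      hBC, real_inner_comm A B, real_inner_comm A C, real_inner_comm B C]
    rw [hF, hx, hy, ht]; ring
  rw [e1, e2, e3] at hcs
  exact le_R_of_ellipse ha.1 ht0 (by rw [← hF]; linarith)

end monogamy

/-! ### The parameter functions -/

theorem R_le_half {y : ℝ} (hy : 1 / 2 ≤ y) : R y ≤ 1 / 2 := by
  have : Real.sqrt (3 * (1 - y ^ 2)) ≤ 3 / 2 :=
    Real.sqrt_le_iff.mpr ⟨by norm_num, by nlinarith⟩
  unfold R; linarith

theorem R_le_R {β y : ℝ} (hβ : 0 ≤ β) (h : β ≤ y) : R y ≤ R β := by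
  have : Real.sqrt (3 * (1 - y ^ 2)) ≤ Real.sqrt (3 * (1 - β ^ 2)) :=
    Real.sqrt_le_sqrt (by nlinarith)
  unfold R; linarith

theorem R_nonneg {y : ℝ} (hy : 0 ≤ y) (h : y ≤ Real.sqrt 3 / 2) : 0 ≤ R y := by
  have h3 : Real.sqrt 3 ^ 2 = 3 := Real.sq_sqrt (by norm_num)
  have : y ≤ Real.sqrt (3 * (1 - y ^ 2)) := Real.le_sqrt_of_sq_le (by nlinarith)
  unfold R; linarith

theorem R_nonpos {y : ℝ} (h : Real.sqrt 3 / 2 ≤ y) : R y ≤ 0 := by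
  have h3 : Real.sqrt 3 ^ 2 = 3 := Real.sq_sqrt (by norm_num)
  have h0 : 0 ≤ Real.sqrt 3 := Real.sqrt_nonneg _
  have : Real.sqrt (3 * (1 - y ^ 2)) ≤ y := Real.sqrt_le_iff.mpr ⟨by linarith, by nlinarith⟩
  unfold R; linarith

theorem pos_nonneg (x : ℝ) : 0 ≤ pos x := le_max_right _ _

theorem pos_of_nonneg {x : ℝ} (h : 0 ≤ x) : pos x = x := max_eq_left h

theorem pos_of_nonpos {x : ℝ} (h : x ≤ 0) : pos x = 0 := max_eq_right h

theorem pos_le_one {x : ℝ} (h : x ≤ 1) : pos x ≤ 1 := max_le h zero_le_one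

theorem Q_le_one {x : ℝ} (h : 0 ≤ x) : Q x ≤ 1 := by
  unfold Q
  split_ifs with h1
  · linarith
  · linarith [R_le_half (not_le.mp h1).le]
  · exact zero_le_one

/-- The polynomial inequality behind the star bound with a distinguished strong edge. -/
theorem star_polynomial_pos {p x y : ℝ} (hp : 2 ≤ p) (hy : 1 / 2 ≤ y) (hx : 0 ≤ x)
    (hxy : x + y ≤ 1) (hE : 3 / 4 ≤ x ^ 2 + x * y + y ^ 2) :
    4 * (1 - y ^ 2) * (1 - x) * (p + x) < (p * y + x + 2 * x * y) ^ 2 := by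
  have hx2 : x ^ 2 ≤ x / 2 := by nlinarith
  have hxy4 : x * y ≤ 1 / 4 := by nlinarith [sq_nonneg (x - y)]
  -- As a polynomial in `p - 2`, right side minus left side has leading coefficient `y²`; `hb` signs
  -- the linear coefficient and `h2` the constant term.
  have hb : 0 ≤ 8 * y ^ 2 + 2 * x * y + 4 * x - 4 := by nlinarith
  have h2 : 0 < 12 * y ^ 2 + 5 * x ^ 2 + 4 * x * y + 4 * x * y ^ 2 + 4 * x ^ 2 * y + 4 * x - 8 := by
    nlinarith [mul_nonneg hx (sub_nonneg.mpr hy), sq_nonneg (x - 1 / 2), sq_nonneg (y - 1 / 2),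
      mul_nonneg (mul_nonneg hx (sub_nonneg.mpr hy)) hx,
      mul_nonneg (mul_nonneg hx (sub_nonneg.mpr hy)) (sub_nonneg.mpr hy)]
  have h3 := mul_nonneg (sub_nonneg.mpr hp) hb
  have h4 : 0 ≤ ((p - 2) * y) ^ 2 := sq_nonneg _
  linarith

/-! ### Monogamy of a star with one distinguished edge -/

section monogamy

variable {n : ℕ} {Γ : Matrix (PauliMon n 2) (PauliMon n 2) ℝ}

/-- No leaf is covered by `R ≥ 0`, one leaf by the triangle inequality. From two leaves on, the
distinguished star inequality, with `p - (p - 1) x - x² = (1 - x)(p + x)`, contradicts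
`star_polynomial_pos`. -/
theorem sum_gval_le_R (hΓ : IsMoment Γ) {i j : Fin n} (hij : i ≠ j) {K : Finset (Fin n)}
    (hi : i ∉ K) (hj : j ∉ K) (hpos : ∀ k ∈ K, 0 < gval Γ i k) (h1 : 1 / 2 < gval Γ i j)
    (h2 : gval Γ i j ≤ Real.sqrt 3 / 2) : ∑ k ∈ K, gval Γ i k ≤ R (gval Γ i j) := by
  have hs1 : gval Γ i j + ∑ k ∈ K, gval Γ i k ≤ 1 := by
    rw [← Finset.sum_insert hj]
    exact sum_gval_le_one hΓ (by simp [hi, hij])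
  have hx0 : 0 ≤ ∑ k ∈ K, gval Γ i k := Finset.sum_nonneg fun k hk => (hpos k hk).le
  rcases Nat.lt_or_ge (#K) 2 with hc | hc
  · interval_cases hK : #K
    · rw [Finset.card_eq_zero.mp hK, Finset.sum_empty]
      exact R_nonneg (by linarith) h2
    · obtain ⟨k, rfl⟩ := Finset.card_eq_one.mp hK
      rw [Finset.sum_singleton]
      simp only [Finset.mem_singleton] at hi hj
      exact gval_le_R hΓ hij hi hj
  · have hp : (2 : ℝ) ≤ #K := by exact_mod_cast hc
    have hsq := sum_gval_sq_le hΓ hij hi hj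
    generalize gval Γ i j = y at *
    generalize ∑ k ∈ K, gval Γ i k = x at *
    generalize (#K : ℝ) = p at *
    by_contra! hR
    have hE : 3 / 4 ≤ x ^ 2 + x * y + y ^ 2 := by
      unfold R at hR
      have h3 : Real.sqrt (3 * (1 - y ^ 2)) ≤ 2 * x + y := by linarith
      have h4 := (Real.sqrt_le_left (by linarith)).mp h3
      linarith
    have h5 := star_polynomial_pos hp h1.le hx0 (by linarith) hE
    have h6 := hsq (by positivity)
    linarith

theorem sum_pos_gval_eq (Γ : Matrix (PauliMon n 2) (PauliMon n 2) ℝ) (i : Fin n)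
    (K : Finset (Fin n)) :
    ∑ k ∈ K, pos (gval Γ i k) = ∑ k ∈ K with 0 < gval Γ i k, gval Γ i k := by
  rw [Finset.sum_filter]
  refine Finset.sum_congr rfl fun k _ => ?_
  split_ifs with h
  · exact pos_of_nonneg h.le
  · exact pos_of_nonpos (not_lt.mp h)

/-- The total entanglement of a vertex with its other neighbours is at most `Q(g⁺)`. -/
theorem sum_pos_gval_le_Q (hΓ : IsMoment Γ) {i j : Fin n} (hij : i ≠ j) {K : Finset (Fin n)}
    (hi : i ∉ K) (hj : j ∉ K) : ∑ k ∈ K, pos (gval Γ i k) ≤ Q (pos (gval Γ i j)) := by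
  rw [sum_pos_gval_eq]
  set K' := K.filter fun k => 0 < gval Γ i k with hK'
  have hi' : i ∉ K' := fun h => hi (Finset.mem_of_mem_filter _ h)
  have hj' : j ∉ K' := fun h => hj (Finset.mem_of_mem_filter _ h)
  have hpos : ∀ k ∈ K', 0 < gval Γ i k := fun k hk => (Finset.mem_filter.mp hk).2
  unfold Q
  split_ifs with h1 h2
  · rcases le_total (gval Γ i j) 0 with h | h
    · rw [pos_of_nonpos h, sub_zero]
      exact sum_gval_le_one hΓ hi'
    · have : gval Γ i j + ∑ k ∈ K', gval Γ i k ≤ 1 := by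
        rw [← Finset.sum_insert hj']
        exact sum_gval_le_one hΓ (by simp [hi', hij])
      rw [pos_of_nonneg h]; linarith
  · have h0 : 0 ≤ gval Γ i j := by
      by_contra! h
      rw [pos_of_nonpos h.le] at h1; norm_num at h1
    rw [pos_of_nonneg h0] at h1 h2 ⊢
    exact sum_gval_le_R hΓ hij hi' hj' hpos (not_le.mp h1) h2
  · have h0 : 0 ≤ gval Γ i j := by
      by_contra! h
      rw [pos_of_nonpos h.le] at h1; norm_num at h1
    rw [pos_of_nonneg h0] at h2
    -- Beyond `√3/2` the function `R` is nonpositive, so the triangle inequality leaves no positive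
    -- neighbour.
    have : K' = ∅ := Finset.eq_empty_of_forall_notMem fun k hk => by
      have h3 := gval_le_R hΓ hij (fun h => hi' (h ▸ hk)) (fun h => hj' (h ▸ hk))
      linarith [hpos k hk, R_nonpos (not_le.mp h2).le]
    rw [this, Finset.sum_empty]

end monogamy

/-! ### The angle function -/

theorem ThetaClass.prod_ge_finset {Θ : ℝ → ℝ} (hΘ : ThetaClass Θ) {ι : Type*} (s : Finset ι)
    (x : ι → ℝ) (hx : ∀ i ∈ s, 0 ≤ x i) (hs : ∑ i ∈ s, x i ≤ 1) :
    1 - Θ (∑ i ∈ s, x i) ≤ ∏ i ∈ s, (1 - Θ (x i)) := by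
  have e1 : ∑ k, x (s.equivFin.symm k) = ∑ i ∈ s, x i := by
    rw [Equiv.sum_comp s.equivFin.symm fun i : s => x i, Finset.sum_coe_sort]
  have e2 : ∏ k, (1 - Θ (x (s.equivFin.symm k))) = ∏ i ∈ s, (1 - Θ (x i)) := by
    rw [Equiv.prod_comp s.equivFin.symm fun i : s => 1 - Θ (x i),
      Finset.prod_coe_sort s fun i => 1 - Θ (x i)]
  rw [← e1, ← e2]
  refine hΘ.prod_ge _ _ (fun k => ⟨hx _ (s.equivFin.symm k).2, ?_⟩) (e1.trans_le hs)
  exact (Finset.single_le_sum hx (s.equivFin.symm k).2).trans hs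

theorem sin_nu_nonneg (β : ℝ) (Θ Λ : ℝ → ℝ) (x : ℝ) : 0 ≤ Real.sin (nu β Θ Λ x) :=
  Real.sin_nonneg_of_nonneg_of_le_pi (Real.arcsin_nonneg.mpr (Real.sqrt_nonneg _))
    ((Real.arcsin_le_pi_div_two _).trans (by linarith [Real.pi_pos]))

theorem cos_nu_nonneg (β : ℝ) (Θ Λ : ℝ → ℝ) (x : ℝ) : 0 ≤ Real.cos (nu β Θ Λ x) :=
  Real.cos_arcsin_nonneg _

section nu

variable {β : ℝ} {Θ Λ : ℝ → ℝ}

theorem sin_nu_le {x : ℝ} (hx : x ≤ 1) (h : x ≤ β)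
    (hΘ : Set.MapsTo Θ (Set.Icc 0 1) (Set.Icc 0 1)) :
    Real.sin (nu β Θ Λ x) = Real.sqrt (Θ (pos x)) := by
  have h1 := hΘ ⟨pos_nonneg x, pos_le_one hx⟩
  rw [nu, if_pos h, Real.sin_arcsin (by linarith [Real.sqrt_nonneg (Θ (pos x))])
    (Real.sqrt_le_one.mpr h1.2)]

theorem sin_nu_gt {x : ℝ} (hx : x ≤ 1) (h : β < x)
    (hΛ : Set.MapsTo Λ (Set.Icc 0 1) (Set.Icc 0 1)) :
    Real.sin (nu β Θ Λ x) = Real.sqrt (Λ (pos x)) := by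
  have h1 := hΛ ⟨pos_nonneg x, pos_le_one hx⟩
  rw [nu, if_neg (not_le.mpr h), Real.sin_arcsin (by linarith [Real.sqrt_nonneg (Λ (pos x))])
    (Real.sqrt_le_one.mpr h1.2)]

theorem cos_sq_nu_le {x : ℝ} (hx : x ≤ 1) (h : x ≤ β)
    (hΘ : Set.MapsTo Θ (Set.Icc 0 1) (Set.Icc 0 1)) :
    Real.cos (nu β Θ Λ x) ^ 2 = 1 - Θ (pos x) := by
  rw [Real.cos_sq', sin_nu_le hx h hΘ, Real.sq_sqrt (hΘ ⟨pos_nonneg x, pos_le_one hx⟩).1]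

theorem cos_sq_nu_gt {x : ℝ} (hx : x ≤ 1) (h : β < x)
    (hΛ : Set.MapsTo Λ (Set.Icc 0 1) (Set.Icc 0 1)) :
    Real.cos (nu β Θ Λ x) ^ 2 = 1 - Λ (pos x) := by
  rw [Real.cos_sq', sin_nu_gt hx h hΛ, Real.sq_sqrt (hΛ ⟨pos_nonneg x, pos_le_one hx⟩).1]

end nu

/-! ### Bounds on the vertex factors -/

section Acoef

variable {n : ℕ} {G : SimpleGraph (Fin n)} {Γ : Matrix (PauliMon n 2) (PauliMon n 2) ℝ}
  {β : ℝ} {Θ Λ : ℝ → ℝ}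

theorem Acoef_nonneg (i j : Fin n) : 0 ≤ Acoef (nu β Θ Λ) G Γ i j :=
  Finset.prod_nonneg fun _ _ => cos_nu_nonneg _ _ _ _

/-- By the defining inequality of `ThetaClass`, pooling the weak neighbours into a single one of
total value only lowers the product; monotonicity of `Θ` then replaces the total by its bound `q`.
-/
theorem prod_cos_sq_nu_ge (hΓ : IsMoment Γ) (hΘ : ThetaClass Θ) {i : Fin n}
    {K : Finset (Fin n)} (hi : i ∉ K) (hK : ∀ k ∈ K, gval Γ i k ≤ β) {q : ℝ}
    (hq : ∑ k ∈ K, pos (gval Γ i k) ≤ q) (hq1 : q ≤ 1) :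
    1 - Θ q ≤ ∏ k ∈ K, Real.cos (nu β Θ Λ (gval Γ i k)) ^ 2 := by
  have h0 : 0 ≤ ∑ k ∈ K, pos (gval Γ i k) := Finset.sum_nonneg fun _ _ => pos_nonneg _
  have h1 := hΘ.prod_ge_finset K _ (fun k _ => pos_nonneg (gval Γ i k)) (hq.trans hq1)
  have h2 := hΘ.mono ⟨h0, hq.trans hq1⟩ ⟨h0.trans hq, hq1⟩ hq
  have h3 : ∏ k ∈ K, Real.cos (nu β Θ Λ (gval Γ i k)) ^ 2 =
      ∏ k ∈ K, (1 - Θ (pos (gval Γ i k))) :=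
    Finset.prod_congr rfl fun k hk => cos_sq_nu_le
      (abs_le.mp (abs_gval_le_one hΓ (ne_of_mem_of_not_mem hk hi).symm)).2 (hK k hk) hΘ.mapsTo
  rw [h3]; linarith

theorem Acoef_ge_of_forall_le (hΓ : IsMoment Γ) (hΘ : ThetaClass Θ) {i j : Fin n} (hij : i ≠ j)
    (h : ∀ k, G.Adj i k → k ≠ j → gval Γ i k ≤ β) :
    Real.sqrt (1 - Θ (Q (pos (gval Γ i j)))) ≤ Acoef (nu β Θ Λ) G Γ i j := by
  classical
  refine Real.sqrt_le_iff.mpr ⟨Acoef_nonneg i j, ?_⟩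
  unfold Acoef
  rw [← Finset.prod_pow]
  have hi : ∀ (d : DecidablePred fun k => G.Adj i k ∧ k ≠ j),
      i ∉ @Finset.filter _ (fun k => G.Adj i k ∧ k ≠ j) d univ := by simp
  refine prod_cos_sq_nu_ge hΓ hΘ (hi _) (fun k hk => ?_)
    (sum_pos_gval_le_Q hΓ hij (hi _) (by simp)) (Q_le_one (pos_nonneg _))
  simp only [Finset.mem_filter, Finset.mem_univ, true_and] at hk
  exact h k hk.1 hk.2

/-- The strong neighbour `k` contributes `1 - Λ`. All others satisfy `g ≤ R(g_{ik}) ≤ 1/2 < β`,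
hence use `Θ`, and share what `g_{ij}⁺` leaves of the budget `Q(g_{ik}⁺)`. The result is `f(g_{ij},
g_{ik})`, which `LambdaClass` bounds below by `f*`. -/
theorem Acoef_ge_of_exists_gt (hΓ : IsMoment Γ) (hΘ : ThetaClass Θ) (hΛ : LambdaClass Θ β Λ)
    (hβ : 1 / 2 < β) {i j k : Fin n} (hij : i ≠ j) (hik : G.Adj i k) (hkj : k ≠ j)
    (hk : β < gval Γ i k) :
    gval Γ i j ≤ R β ∧ fStar Θ Λ (gval Γ i j) ≤ Acoef (nu β Θ Λ) G Γ i j := by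
  classical
  have hik' : i ≠ k := hik.ne
  have hy1 := (abs_le.mp (abs_gval_le_one hΓ hik')).2
  have hg1 := (abs_le.mp (abs_gval_le_one hΓ hij)).1
  have hgR : gval Γ i j ≤ R β :=
    (gval_le_R hΓ hik' hij hkj).trans (R_le_R (by linarith) hk.le)
  refine ⟨hgR, (hΛ.fStar_le _ (gval Γ i k) hg1 hgR hk.le (gval_le_R hΓ hij hik' hkj.symm)).trans ?_⟩
  refine Real.sqrt_le_iff.mpr ⟨Acoef_nonneg i j, ?_⟩
  unfold Acoef
  rw [← Finset.prod_pow]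
  set N := univ.filter fun k => G.Adj i k ∧ k ≠ j with hN
  have hkN : k ∈ N := by simp [hN, hik, hkj]
  rw [← Finset.mul_prod_erase N _ hkN, cos_sq_nu_gt hy1 hk hΛ.mapsTo]
  have hΛ1 := (hΛ.mapsTo ⟨pos_nonneg (gval Γ i k), pos_le_one hy1⟩).2
  refine mul_le_mul_of_nonneg_left ?_ (by linarith)
  have hiN : i ∉ N.erase k := by simp [hN]
  have hjN : j ∉ N.erase k := by simp [hN]
  -- The budget is that of the strong edge `ik`, and `j` is one of the vertices drawing on it.
  have hsum : pos (gval Γ i j) + ∑ l ∈ N.erase k, pos (gval Γ i l) ≤ Q (pos (gval Γ i k)) := by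
    rw [← Finset.sum_insert (f := fun l => pos (gval Γ i l)) hjN]
    exact sum_pos_gval_le_Q hΓ hik' (by simp [hij, hN]) (by simp [hkj])
  refine prod_cos_sq_nu_ge hΓ hΘ hiN (fun l hl => ?_) (by linarith)
    (by linarith [Q_le_one (pos_nonneg (gval Γ i k)), pos_nonneg (gval Γ i j)])
  simp only [hN, Finset.mem_erase, Finset.mem_filter, Finset.mem_univ, true_and] at hl
  have := gval_le_R hΓ hik' hl.2.1.ne hl.1.symm
  linarith [R_le_half (by linarith : 1 / 2 ≤ gval Γ i k)]

end Acoef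

/-! ### The bound on a single edge -/

section edge

variable {β : ℝ} {Θ Λ : ℝ → ℝ}

theorem fStar_nonneg (g : ℝ) : 0 ≤ fStar Θ Λ g := Real.sqrt_nonneg _

theorem minBound_mul_le {b : ℝ} {S : Set ℝ} {r : ℝ → ℝ} {N : ℝ → ℝ}
    (hr : ∀ g ∈ S, r g = N g / (2 * (1 + g))) (hN : ∀ g ∈ S, 0 ≤ N g) (hS : ∀ g ∈ S, -1 < g)
    (hb : b ≤ sInf (r '' S)) {g : ℝ} (hg : g ∈ S) : b * (1 + g) ≤ N g / 2 := by
  -- Without a lower bound the real infimum would be the default value `0` and bound nothing.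
  have hbd : BddBelow (r '' S) := ⟨0, by
    rintro _ ⟨x, hx, rfl⟩
    rw [hr x hx]
    exact div_nonneg (hN x hx) (by linarith [hS x hx])⟩
  have h1 := hb.trans (csInf_le hbd ⟨g, hg, rfl⟩)
  have h2 : 0 < 2 * (1 + g) := by linarith [hS g hg]
  rw [hr g hg, le_div_iff₀ h2] at h1
  linarith

theorem Q_mem {x : ℝ} (hx : x ∈ Set.Icc (0 : ℝ) 1) : Q x ∈ Set.Icc (0 : ℝ) 1 := by
  refine ⟨?_, Q_le_one hx.1⟩
  unfold Q
  split_ifs with h1 h2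
  · linarith
  · exact R_nonneg hx.1 h2
  · exact le_rfl

theorem minBound_mul_le_r1 (hΘ : Set.MapsTo Θ (Set.Icc 0 1) (Set.Icc 0 1))
    (hβ' : β ≤ 1) {g : ℝ} (hg : g ∈ Set.Icc 0 β) :
    minBound β Θ Λ * (1 + g) ≤
      (2 - Θ (Q (pos g)) + 2 * Real.sqrt (Θ (pos g) * (1 - Θ (Q (pos g))))) / 2 := by
  refine minBound_mul_le (r := r1 Θ)
    (N := fun g => 2 - Θ (Q (pos g)) + 2 * Real.sqrt (Θ (pos g) * (1 - Θ (Q (pos g)))))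
    (fun _ _ => rfl) (fun x hx => ?_) (fun x hx => by linarith [hx.1]) (min_le_left _ _) hg
  have := (hΘ (Q_mem ⟨pos_nonneg x, pos_le_one (hx.2.trans hβ')⟩)).2
  have := Real.sqrt_nonneg (Θ (pos x) * (1 - Θ (Q (pos x))))
  linarith

theorem minBound_mul_le_r2 (hΘ : Set.MapsTo Θ (Set.Icc 0 1) (Set.Icc 0 1))
    (hβ : 0 ≤ β) {g : ℝ} (hg : g ∈ Set.Icc β 1) :
    minBound β Θ Λ * (1 + g) ≤
      (2 - Θ (Q (pos g)) + 2 * Real.sqrt (Λ (pos g) * (1 - Θ (Q (pos g))))) / 2 := by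
  refine minBound_mul_le (r := r2 Θ Λ)
    (N := fun g => 2 - Θ (Q (pos g)) + 2 * Real.sqrt (Λ (pos g) * (1 - Θ (Q (pos g)))))
    (fun _ _ => rfl) (fun x hx => ?_) (fun x hx => by linarith [hx.1])
    ((min_le_right _ _).trans (min_le_left _ _)) hg
  have := (hΘ (Q_mem ⟨pos_nonneg x, pos_le_one hx.2⟩)).2
  have := Real.sqrt_nonneg (Λ (pos x) * (1 - Θ (Q (pos x))))
  linarith

theorem minBound_mul_le_r3 {g : ℝ} (hg : g ∈ Set.Ioc (-1) (R β)) :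
    minBound β Θ Λ * (1 + g) ≤
      (1 + fStar Θ Λ g ^ 2 + 2 * Real.sqrt (Θ (pos g)) * fStar Θ Λ g) / 2 := by
  refine minBound_mul_le (r := r3 Θ Λ)
    (N := fun g => 1 + fStar Θ Λ g ^ 2 + 2 * Real.sqrt (Θ (pos g)) * fStar Θ Λ g)
    (fun _ _ => rfl) (fun x hx => ?_) (fun x hx => hx.1)
    ((min_le_right _ _).trans (min_le_right _ _)) hg
  have := fStar_nonneg (Θ := Θ) (Λ := Λ) x
  positivity

/-- The edge term is monotone in the vertex factors. -/
theorem edge_term_mono {A B T s : ℝ} (hT : 0 ≤ T) (hs : 0 ≤ s) (hA : T ≤ A) (hB : T ≤ B) :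
    1 + T ^ 2 + 2 * s * T ≤ 1 + A * B + (A + B) * s := by
  nlinarith [mul_le_mul hA hB hT (hT.trans hA), mul_nonneg hs (sub_nonneg.mpr hA),
    mul_nonneg hs (sub_nonneg.mpr hB)]

variable {n : ℕ} {G : SimpleGraph (Fin n)} {Γ : Matrix (PauliMon n 2) (PauliMon n 2) ℝ}

/-- An edge above `β` has only weak edges next to it, which gives `r2`. Otherwise both vertex
factors are at least the smaller of the bounds available at the two ends: `√(1 - Θ(Q))` leads to
`r1`, and `f*` leads to `r3`. -/
theorem minBound_mul_le_edge (hΓ : IsMoment Γ) (hΘ : ThetaClass Θ) (hΛ : LambdaClass Θ β Λ)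
    (hβ : 1 / 2 < β) (hβ' : β ≤ 1) {i j : Fin n} (hij : i ≠ j) :
    minBound β Θ Λ * (1 + gval Γ i j) ≤ (1 + Acoef (nu β Θ Λ) G Γ i j * Acoef (nu β Θ Λ) G Γ j i
      + (Acoef (nu β Θ Λ) G Γ i j + Acoef (nu β Θ Λ) G Γ j i) *
        Real.sin (nu β Θ Λ (gval Γ i j))) / 2 := by
  have hg := abs_le.mp (abs_gval_le_one hΓ hij)
  have hQg := Q_mem (x := pos (gval Γ i j)) ⟨pos_nonneg _, pos_le_one hg.2⟩
  have hΘQ := hΘ.mapsTo hQg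
  have hΘg := hΘ.mapsTo ⟨pos_nonneg (gval Γ i j), pos_le_one hg.2⟩
  have hT2 : Real.sqrt (1 - Θ (Q (pos (gval Γ i j)))) ^ 2 = 1 - Θ (Q (pos (gval Γ i j))) :=
    Real.sq_sqrt (by linarith [hΘQ.2])
  have hT0 : 0 ≤ Real.sqrt (1 - Θ (Q (pos (gval Γ i j)))) := Real.sqrt_nonneg _
  have hs0 := sin_nu_nonneg β Θ Λ (gval Γ i j)
  have hi := Acoef_ge_of_forall_le (G := G) (Λ := Λ) (β := β) hΓ hΘ hij
  have hj := Acoef_ge_of_forall_le (G := G) (Λ := Λ) (β := β) hΓ hΘ hij.symm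
  have hi' := fun k => Acoef_ge_of_exists_gt (G := G) (k := k) hΓ hΘ hΛ hβ hij
  have hj' := fun k => Acoef_ge_of_exists_gt (G := G) (k := k) hΓ hΘ hΛ hβ hij.symm
  have hA0 := Acoef_nonneg (G := G) (Γ := Γ) (β := β) (Θ := Θ) (Λ := Λ) i j
  have hB0 := Acoef_nonneg (G := G) (Γ := Γ) (β := β) (Θ := Θ) (Λ := Λ) j i
  rw [gval_comm Γ j i] at hj hj'
  rcases lt_or_ge β (gval Γ i j) with hgβ | hgβ
  · have hsmall : ∀ {a b k : Fin n}, a ≠ b → gval Γ a b = gval Γ i j → G.Adj a k → k ≠ b →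
        gval Γ a k ≤ β := fun {a b k} hab he hak hkb => by
      have h1 := gval_le_R hΓ hab hak.ne hkb.symm
      rw [he] at h1
      linarith [R_le_half (by linarith : 1 / 2 ≤ gval Γ i j)]
    have h := edge_term_mono hT0 hs0 (hi fun k => hsmall hij rfl)
      (hj fun k => hsmall hij.symm (gval_comm Γ j i))
    have h2 := minBound_mul_le_r2 (Λ := Λ) hΘ.mapsTo (by linarith : 0 ≤ β) ⟨hgβ.le, hg.2⟩
    rw [Real.sqrt_mul (hΛ.mapsTo ⟨pos_nonneg (gval Γ i j), pos_le_one hg.2⟩).1] at h2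
    rw [hT2] at h
    rw [sin_nu_gt hg.2 hgβ hΛ.mapsTo] at h ⊢
    linarith
  · have hsin := sin_nu_le (Λ := Λ) hg.2 hgβ hΘ.mapsTo
    have key1 : Real.sqrt (1 - Θ (Q (pos (gval Γ i j)))) ≤ Acoef (nu β Θ Λ) G Γ i j →
        Real.sqrt (1 - Θ (Q (pos (gval Γ i j)))) ≤ Acoef (nu β Θ Λ) G Γ j i →
        minBound β Θ Λ * (1 + gval Γ i j) ≤ (1 + Acoef (nu β Θ Λ) G Γ i j *
          Acoef (nu β Θ Λ) G Γ j i + (Acoef (nu β Θ Λ) G Γ i j + Acoef (nu β Θ Λ) G Γ j i) *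
            Real.sin (nu β Θ Λ (gval Γ i j))) / 2 := fun h1 h2 => by
      have h := edge_term_mono hT0 hs0 h1 h2
      rw [hT2] at h
      refine le_trans ?_ (div_le_div_of_nonneg_right h zero_le_two)
      rw [hsin]
      rcases le_total 0 (gval Γ i j) with h0 | h0
      · have h3 := minBound_mul_le_r1 (Λ := Λ) hΘ.mapsTo hβ' ⟨h0, hgβ⟩
        rw [Real.sqrt_mul hΘg.1] at h3
        linarith
      · have h3 := minBound_mul_le_r1 (Λ := Λ) hΘ.mapsTo hβ' (g := 0) ⟨le_rfl, by linarith⟩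
        rw [pos_of_nonpos h0] at hΘQ ⊢
        rw [pos_of_nonpos le_rfl, hΘ.zero] at h3
        rw [hΘ.zero]
        simp only [zero_mul, Real.sqrt_zero, mul_zero, add_zero, mul_one] at h3 ⊢
        have h4 : 0 ≤ (2 - Θ (Q 0)) / 2 := by linarith [hΘQ.2]
        have h5 := mul_le_mul_of_nonneg_right h3 (by linarith : 0 ≤ 1 + gval Γ i j)
        nlinarith
    have key3 : gval Γ i j ≤ R β → fStar Θ Λ (gval Γ i j) ≤ Acoef (nu β Θ Λ) G Γ i j →
        fStar Θ Λ (gval Γ i j) ≤ Acoef (nu β Θ Λ) G Γ j i →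
        minBound β Θ Λ * (1 + gval Γ i j) ≤ (1 + Acoef (nu β Θ Λ) G Γ i j *
          Acoef (nu β Θ Λ) G Γ j i + (Acoef (nu β Θ Λ) G Γ i j + Acoef (nu β Θ Λ) G Γ j i) *
            Real.sin (nu β Θ Λ (gval Γ i j))) / 2 := fun hR h1 h2 => by
      -- `r3` is not taken at `g = -1`, but there the left side is zero.
      rcases hg.1.eq_or_lt with h0 | h0
      · rw [← h0]
        rw [← h0] at hs0
        have : 0 ≤ (1 + Acoef (nu β Θ Λ) G Γ i j *
          Acoef (nu β Θ Λ) G Γ j i + (Acoef (nu β Θ Λ) G Γ i j + Acoef (nu β Θ Λ) G Γ j i) *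
            Real.sin (nu β Θ Λ (-1))) / 2 := by positivity
        simpa using this
      · have h := edge_term_mono (fStar_nonneg _) hs0 h1 h2
        have h3 := minBound_mul_le_r3 (Θ := Θ) (Λ := Λ) ⟨h0, hR⟩
        rw [hsin] at h ⊢
        linarith
    by_cases ci : ∀ k, G.Adj i k → k ≠ j → gval Γ i k ≤ β
    · by_cases cj : ∀ k, G.Adj j k → k ≠ i → gval Γ j k ≤ β
      · exact key1 (hi ci) (hj cj)
      · push Not at cj
        obtain ⟨k, hk1, hk2, hk3⟩ := cj
        obtain ⟨hR, hF⟩ := hj' k hk1 hk2 hk3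
        -- Only `j` has a strong neighbour, so the ends have different bounds and the smaller one
        -- serves for both.
        rcases le_total (Real.sqrt (1 - Θ (Q (pos (gval Γ i j))))) (fStar Θ Λ (gval Γ i j)) with
          hc | hc
        · exact key1 (hi ci) (hc.trans hF)
        · exact key3 hR (hc.trans (hi ci)) hF
    · push Not at ci
      obtain ⟨k, hk1, hk2, hk3⟩ := ci
      obtain ⟨hR, hF⟩ := hi' k hk1 hk2 hk3
      by_cases cj : ∀ k, G.Adj j k → k ≠ i → gval Γ j k ≤ β
      · rcases le_total (Real.sqrt (1 - Θ (Q (pos (gval Γ i j))))) (fStar Θ Λ (gval Γ i j)) with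
          hc | hc
        · exact key1 (hc.trans hF) (hj cj)
        · exact key3 hR hF (hc.trans (hj cj))
      · push Not at cj
        obtain ⟨l, hl1, hl2, hl3⟩ := cj
        exact key3 hR hF (hj' l hl1 hl2 hl3).2

end edge

/-! ### Product vectors -/

/-- The product vector `v₁ ⊗ ⋯ ⊗ vₙ`. -/
def tensorVec {n : ℕ} (v : Fin n → Fin 2 → ℂ) : (Fin n → Fin 2) → ℂ :=
  fun t => ∏ k, v k (t k)

theorem tensorOp_mulVec {n : ℕ} (A : Fin n → Matrix (Fin 2) (Fin 2) ℂ) (v : Fin n → Fin 2 → ℂ) :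
    (tensorOp A).mulVec (tensorVec v) = tensorVec fun k => (A k).mulVec (v k) := by
  ext s
  simp only [tensorOp, tensorVec, Matrix.mulVec, dotProduct, Matrix.of_apply,
    Finset.prod_univ_sum, Fintype.piFinset_univ, Finset.prod_mul_distrib]

theorem star_tensorVec_dotProduct {n : ℕ} (v w : Fin n → Fin 2 → ℂ) :
    dotProduct (star (tensorVec v)) (tensorVec w) = ∏ k, dotProduct (star (v k)) (w k) := by
  simp only [tensorVec, dotProduct, Pi.star_apply, Finset.prod_univ_sum, Fintype.piFinset_univ,
    star_prod, Finset.prod_mul_distrib]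

theorem site_mulVec_apply {n : ℕ} (σ : Pauli) (i : Fin n) (v : Fin n → Fin 2 → ℂ)
    (t : Fin n → Fin 2) :
    (site σ i).mulVec (tensorVec v) t =
      σ.mat.mulVec (v i) (t i) * ∏ k ∈ univ.erase i, v k (t k) := by
  rw [site, tensorOp_mulVec, tensorVec, ← Finset.mul_prod_erase univ _ (Finset.mem_univ i)]
  rw [if_pos rfl]
  congr 1
  refine Finset.prod_congr rfl fun k hk => ?_
  rw [if_neg (Finset.ne_of_mem_erase hk), Matrix.one_mulVec]

/-! ### The common eigenbasis of the gates -/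

/-- The sign of a Boolean. -/
def sgn (b : Bool) : ℝ := if b then 1 else -1

theorem sgn_not (b : Bool) : sgn (!b) = -sgn b := by cases b <;> simp [sgn]

theorem sgn_mul_self (b : Bool) : sgn b * sgn b = 1 := by cases b <;> simp [sgn]

/-- The phase `e^{-iπ/4}`. -/
def phase : ℂ := (1 - Complex.I) / (Real.sqrt 2 : ℝ)

theorem sqrt_two_sq : ((Real.sqrt 2 : ℝ) : ℂ) ^ 2 = 2 := by
  rw [← Complex.ofReal_pow, Real.sq_sqrt zero_le_two]; norm_num

theorem sqrt_two_ne_zero : ((Real.sqrt 2 : ℝ) : ℂ) ≠ 0 := by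
  intro h; have := sqrt_two_sq; rw [h] at this; norm_num at this

theorem one_add_I_mul_phase : (1 + Complex.I) * phase = (Real.sqrt 2 : ℝ) := by
  rw [phase, ← mul_div_assoc, div_eq_iff sqrt_two_ne_zero, ← sq, sqrt_two_sq]
  linear_combination -Complex.I_sq

theorem sqrt_two_mul_phase : ((Real.sqrt 2 : ℝ) : ℂ) * phase = 1 - Complex.I := by
  rw [phase, mul_div_cancel₀ _ sqrt_two_ne_zero]

theorem one_sub_I_mul_phase : (1 - Complex.I) * phase = -(Real.sqrt 2 : ℝ) * Complex.I := by
  rw [phase, ← mul_div_assoc, div_eq_iff sqrt_two_ne_zero]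
  linear_combination Complex.I_sq + Complex.I * sqrt_two_sq

theorem star_phase_mul_phase : star phase * phase = 1 := by
  have h : star phase = (1 + Complex.I) / (Real.sqrt 2 : ℝ) := by
    simp [phase]
  rw [h, div_mul_eq_mul_div, one_add_I_mul_phase, div_self sqrt_two_ne_zero]

/-- The eigenvectors of `X - Y`, unnormalized. -/
def qubit (b : Bool) : Fin 2 → ℂ := ![1, sgn b * phase]

theorem qubit_dotProduct (b c : Bool) :
    dotProduct (star (qubit b)) (qubit c) = if b = c then 2 else 0 := by
  have h := star_phase_mul_phase
  simp only [qubit, dotProduct, Fin.sum_univ_two]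
  cases b <;> cases c <;> simp [sgn] at h ⊢ <;> rw [h] <;> norm_num

theorem xMinusY_qubit (b : Bool) :
    (Pauli.X.mat - Pauli.Y.mat).mulVec (qubit b) =
      (((Real.sqrt 2 : ℝ) : ℂ) * sgn b) • qubit b := by
  have h1 := one_add_I_mul_phase
  have h2 := sqrt_two_mul_phase
  ext t
  fin_cases t
  · simp [Pauli.mat, qubit, Matrix.mulVec, dotProduct, Fin.sum_univ_two]
    linear_combination (sgn b : ℂ) * h1
  · have h3 : (sgn b : ℂ) * sgn b = 1 := by exact_mod_cast sgn_mul_self b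
    simp [Pauli.mat, qubit, Matrix.mulVec, dotProduct, Fin.sum_univ_two]
    linear_combination -h2 - ((Real.sqrt 2 : ℝ) : ℂ) * phase * h3

/-- `X + Y` anticommutes with `X - Y`, so it exchanges the two eigenlines. -/
theorem xPlusY_qubit (b : Bool) :
    (Pauli.X.mat + Pauli.Y.mat).mulVec (qubit b) =
      (-((Real.sqrt 2 : ℝ) : ℂ) * Complex.I * sgn b) • qubit (!b) := by
  have h1 := one_sub_I_mul_phase
  have h2 := sqrt_two_mul_phase
  ext t
  fin_cases t
  · simp [Pauli.mat, qubit, Matrix.mulVec, dotProduct, Fin.sum_univ_two]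
    linear_combination (sgn b : ℂ) * h1
  · have h3 : (sgn b : ℂ) * sgn b = 1 := by exact_mod_cast sgn_mul_self b
    simp [Pauli.mat, qubit, Matrix.mulVec, dotProduct, Fin.sum_univ_two, sgn_not]
    linear_combination -Complex.I * h2 - Complex.I * ((Real.sqrt 2 : ℝ) : ℂ) * phase * h3 +
      Complex.I_sq

theorem Z_qubit (b : Bool) : Pauli.Z.mat.mulVec (qubit b) = qubit (!b) := by
  ext t
  fin_cases t <;> simp [Pauli.mat, qubit, Matrix.mulVec, dotProduct, Fin.sum_univ_two, sgn_not]

section circuit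

variable {n : ℕ}

/-- The joint eigenvectors of the operators `X_i - Y_i`, unnormalized. -/
def signVec (s : Fin n → Bool) : (Fin n → Fin 2) → ℂ := tensorVec fun k => qubit (s k)

/-- Flip the sign of the qubit `i`. -/
def flip (i : Fin n) (s : Fin n → Bool) : Fin n → Bool := Function.update s i (!s i)

theorem flip_same (i : Fin n) (s : Fin n → Bool) : flip i s i = !s i := by simp [flip]

theorem flip_of_ne {i k : Fin n} (h : k ≠ i) (s : Fin n → Bool) : flip i s k = s k := by
  simp [flip, h]

theorem signVec_dotProduct (s t : Fin n → Bool) :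
    dotProduct (star (signVec s)) (signVec t) = if s = t then 2 ^ n else 0 := by
  rw [signVec, signVec, star_tensorVec_dotProduct]
  simp only [qubit_dotProduct, Finset.prod_ite_zero, Finset.mem_univ, true_imp_iff,
    Finset.prod_const, Finset.card_univ, Fintype.card_fin, funext_iff]

theorem signVec_eq (i : Fin n) (s : Fin n → Bool) (t : Fin n → Fin 2) :
    signVec s t = qubit (s i) (t i) * ∏ k ∈ univ.erase i, qubit (s k) (t k) := by
  rw [signVec, tensorVec,
    Finset.mul_prod_erase univ (fun k => qubit (s k) (t k)) (Finset.mem_univ i)]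

theorem signVec_flip_eq (i : Fin n) (s : Fin n → Bool) (t : Fin n → Fin 2) :
    signVec (flip i s) t = qubit (!s i) (t i) * ∏ k ∈ univ.erase i, qubit (s k) (t k) := by
  rw [signVec_eq i, flip_same]
  congr 1
  exact Finset.prod_congr rfl fun k hk => by rw [flip_of_ne (Finset.ne_of_mem_erase hk)]

theorem xMinusY_signVec (i : Fin n) (s : Fin n → Bool) :
    (xMinusY i).mulVec (signVec s) = (((Real.sqrt 2 : ℝ) : ℂ) * sgn (s i)) • signVec s := by
  ext t
  have h := congrFun (xMinusY_qubit (s i)) (t i)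
  rw [Matrix.sub_mulVec, Pi.sub_apply] at h
  rw [xMinusY, Matrix.sub_mulVec, Pi.sub_apply, Pi.smul_apply, signVec_eq i, signVec,
    site_mulVec_apply, site_mulVec_apply, ← sub_mul, h, Pi.smul_apply, smul_eq_mul, smul_eq_mul,
    mul_assoc]

theorem xPlusY_signVec (i : Fin n) (s : Fin n → Bool) :
    (site .X i + site .Y i).mulVec (signVec s) =
      (-((Real.sqrt 2 : ℝ) : ℂ) * Complex.I * sgn (s i)) • signVec (flip i s) := by
  ext t
  have h := congrFun (xPlusY_qubit (s i)) (t i)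
  rw [Matrix.add_mulVec, Pi.add_apply] at h
  rw [Matrix.add_mulVec, Pi.add_apply, Pi.smul_apply, signVec_flip_eq i, signVec,
    site_mulVec_apply, site_mulVec_apply, ← add_mul, h, Pi.smul_apply, smul_eq_mul, smul_eq_mul,
    mul_assoc]

theorem Z_signVec (i : Fin n) (s : Fin n → Bool) :
    (site .Z i).mulVec (signVec s) = signVec (flip i s) := by
  ext t
  rw [signVec_flip_eq i, signVec, site_mulVec_apply, Z_qubit]

/-- At each site the two eigenvectors sum to twice `|0⟩`, their second components being opposite. -/
theorem zeroState_eq : zeroState n = (2 ^ n : ℂ)⁻¹ • ∑ s : Fin n → Bool, signVec s := by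
  ext t
  have h1 : (∑ s : Fin n → Bool, signVec s) t = ∏ k, ∑ b, qubit b (t k) := by
    simp only [Finset.sum_apply, signVec, tensorVec, Finset.prod_univ_sum, Fintype.piFinset_univ]
  have h2 : ∀ a : Fin 2, ∑ b, qubit b a = if a = 0 then 2 else 0 := fun a => by
    fin_cases a <;> simp [qubit, sgn]
  rw [Pi.smul_apply, h1]
  simp only [h2, Finset.prod_ite_zero, Finset.mem_univ, true_imp_iff, Finset.prod_const,
    Finset.card_univ, Fintype.card_fin, zeroState, Pi.single_apply, funext_iff]
  split_ifs <;> simp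

/-! ### Action of the circuit -/

-- The exponential series is evaluated at `v` term by term, evaluation being continuous and
-- additive.
open scoped Matrix.Norms.Operator in
theorem exp_mulVec {m : Type*} [Fintype m] [DecidableEq m] {A : Matrix m m ℂ} {v : m → ℂ} {μ : ℂ}
    (h : A.mulVec v = μ • v) : (NormedSpace.exp A).mulVec v = Complex.exp μ • v := by
  have hp : ∀ k : ℕ, (A ^ k).mulVec v = μ ^ k • v := fun k => by
    induction k with
    | zero => simp
    | succ k ih =>
      rw [pow_succ, ← Matrix.mulVec_mulVec, h, Matrix.mulVec_smul, ih, smul_smul, pow_succ,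
        mul_comm]
  have h1 := NormedSpace.exp_series_hasSum_exp' (𝕂 := ℂ) A
  have h2 := NormedSpace.exp_series_hasSum_exp' (𝕂 := ℂ) μ
  have hc : Continuous fun B : Matrix m m ℂ => B.mulVec v :=
    continuous_id.matrix_mulVec continuous_const
  have h3 := h1.map (Matrix.mulVecBilin ℂ ℂ |>.flip v |>.toAddMonoidHom) hc
  have h4 := h2.smul_const v
  rw [Complex.exp_eq_exp_ℂ]
  refine h3.unique ?_
  convert h4 using 1
  ext k : 1
  simp [hp, smul_smul]

theorem gate_signVec (θ : ℝ) (i j : Fin n) (s : Fin n → Bool) :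
    (gate θ i j).mulVec (signVec s) =
      Complex.exp (Complex.I * ((θ * (sgn (s i) * sgn (s j)) / 2 : ℝ) : ℂ)) • signVec s := by
  refine exp_mulVec ?_
  rw [Matrix.smul_mulVec, ← Matrix.mulVec_mulVec, xMinusY_signVec, Matrix.mulVec_smul,
    xMinusY_signVec, smul_smul, smul_smul]
  congr 1
  push_cast
  linear_combination (Complex.I * θ / 4 * sgn (s i) * sgn (s j)) * sqrt_two_sq

/-- The phase acquired by the eigenvector with signs `s`. -/
def edgePhase (G : SimpleGraph (Fin n)) (θ : Fin n → Fin n → ℝ) (s : Fin n → Bool) : ℝ :=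
  ∑ e ∈ edges G, θ e.1 e.2 * (sgn (s e.1) * sgn (s e.2)) / 2

theorem noncommProd_gate_signVec (θ : Fin n → Fin n → ℝ) (s : Fin n → Bool)
    (S : Finset (Fin n × Fin n))
    (hS : (S : Set (Fin n × Fin n)).Pairwise
      (Function.onFun Commute fun e => gate (θ e.1 e.2) e.1 e.2)) :
    (S.noncommProd (fun e => gate (θ e.1 e.2) e.1 e.2) hS).mulVec (signVec s) =
      Complex.exp (Complex.I *
        ((∑ e ∈ S, θ e.1 e.2 * (sgn (s e.1) * sgn (s e.2)) / 2 : ℝ) : ℂ)) • signVec s := by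
  classical
  induction S using Finset.induction_on with
  | empty => simp
  | insert e S he ih =>
    rw [Finset.noncommProd_insert_of_notMem _ _ _ _ he, ← Matrix.mulVec_mulVec, ih,
      Matrix.mulVec_smul, gate_signVec, smul_smul, ← Complex.exp_add, Finset.sum_insert he]
    congr 2
    push_cast
    ring

theorem circuit_signVec (G : SimpleGraph (Fin n)) (θ : Fin n → Fin n → ℝ) (s : Fin n → Bool) :
    (circuit G θ).mulVec (signVec s) =
      Complex.exp (Complex.I * (edgePhase G θ s : ℂ)) • signVec s :=
  noncommProd_gate_signVec θ s (edges G) _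

theorem circuit_zeroState (G : SimpleGraph (Fin n)) (θ : Fin n → Fin n → ℝ) :
    (circuit G θ).mulVec (zeroState n) = ∑ s : Fin n → Bool,
      ((2 ^ n : ℂ)⁻¹ * Complex.exp (Complex.I * (edgePhase G θ s : ℂ))) • signVec s := by
  have hsum := map_sum (Matrix.mulVecLin (circuit G θ)) (fun s : Fin n → Bool => signVec s) univ
  simp only [Matrix.mulVecLin_apply] at hsum
  rw [zeroState_eq, Matrix.mulVec_smul, hsum, Finset.smul_sum]
  refine Finset.sum_congr rfl fun s _ => ?_
  rw [circuit_signVec, smul_smul]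

/-- Matrix elements of an operator that permutes the eigenvectors up to scalars. -/
theorem dotProduct_circuit_zeroState (G : SimpleGraph (Fin n)) (θ : Fin n → Fin n → ℝ)
    {A : Op n} {π : (Fin n → Bool) → Fin n → Bool} {c : (Fin n → Bool) → ℂ}
    (hA : ∀ s, A.mulVec (signVec s) = c s • signVec (π s)) :
    dotProduct (star ((circuit G θ).mulVec (zeroState n)))
      (A.mulVec ((circuit G θ).mulVec (zeroState n))) =
      (2 ^ n : ℂ)⁻¹ * ∑ s, c s * Complex.exp
        (Complex.I * ((edgePhase G θ s - edgePhase G θ (π s) : ℝ) : ℂ)) := by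
  have hsum : ∀ a : (Fin n → Bool) → ℂ, A.mulVec (∑ s, a s • signVec s) =
      ∑ s, (a s * c s) • signVec (π s) := fun a => by
    have h := map_sum (Matrix.mulVecLin A) (fun s : Fin n → Bool => a s • signVec s) univ
    simp only [Matrix.mulVecLin_apply] at h
    rw [h]
    exact Finset.sum_congr rfl fun s _ => by rw [Matrix.mulVec_smul, hA, smul_smul]
  rw [circuit_zeroState, hsum, star_sum, dotProduct_sum, Finset.mul_sum]
  refine Finset.sum_congr rfl fun s _ => ?_
  -- Orthogonality keeps only the bra indexed by `π s`; no injectivity of `π` is needed.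
  rw [sum_dotProduct, Finset.sum_eq_single (π s)]
  · rw [star_smul, smul_dotProduct, dotProduct_smul, signVec_dotProduct, if_pos rfl]
    have hstar : star (Complex.exp (Complex.I * (edgePhase G θ (π s) : ℂ))) =
        Complex.exp (-(Complex.I * (edgePhase G θ (π s) : ℂ))) := by
      rw [Complex.star_def, ← Complex.exp_conj]; simp
    have hexp : Complex.exp (Complex.I * ((edgePhase G θ s - edgePhase G θ (π s) : ℝ) : ℂ)) =
        Complex.exp (-(Complex.I * (edgePhase G θ (π s) : ℂ))) *
          Complex.exp (Complex.I * (edgePhase G θ s : ℂ)) := by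
      rw [← Complex.exp_add]; congr 1; push_cast; ring
    rw [star_mul', hstar, hexp, star_inv₀, star_pow]
    simp only [smul_eq_mul, star_ofNat]
    field_simp
  · intro t _ ht
    rw [star_smul, smul_dotProduct, dotProduct_smul, signVec_dotProduct, if_neg ht]
    simp
  · simp

theorem norm_circuit_zeroState (G : SimpleGraph (Fin n)) (θ : Fin n → Fin n → ℝ) :
    dotProduct (star ((circuit G θ).mulVec (zeroState n)))
      ((circuit G θ).mulVec (zeroState n)) = 1 := by
  have h := dotProduct_circuit_zeroState G θ (A := 1) (π := id) (c := fun _ => 1) (by simp)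
  rw [Matrix.one_mulVec] at h
  rw [h]
  simp

end circuit

/-! ### Phase differences and correlations of the output state -/

section phases

variable {n : ℕ} {G : SimpleGraph (Fin n)} {θ : Fin n → Fin n → ℝ}

open Classical in
/-- The angles, extended by zero to the pairs that are not edges. -/
def angle (G : SimpleGraph (Fin n)) (θ : Fin n → Fin n → ℝ) (k l : Fin n) : ℝ :=
  if G.Adj k l then θ k l else 0

theorem angle_comm (hθ : ∀ k l, θ k l = θ l k) (k l : Fin n) :
    angle G θ k l = angle G θ l k := by
  by_cases h : G.Adj k l
  · rw [angle, angle, if_pos h, if_pos h.symm, hθ]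
  · rw [angle, angle, if_neg h, if_neg fun h' => h h'.symm]

theorem angle_self (k : Fin n) : angle G θ k k = 0 := by simp [angle]

theorem angle_of_adj {k l : Fin n} (h : G.Adj k l) : angle G θ k l = θ k l := if_pos h

/-- The symmetric form visits each edge twice, turning the factor `1/2` of the gate into `1/4`. -/
theorem edgePhase_eq (hθ : ∀ k l, θ k l = θ l k) (s : Fin n → Bool) :
    edgePhase G θ s = (∑ k, ∑ l, angle G θ k l * (sgn (s k) * sgn (s l))) / 4 := by
  classical
  have h1 : edgePhase G θ s = ∑ p : Fin n × Fin n,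
      if p.1 < p.2 then angle G θ p.1 p.2 * (sgn (s p.1) * sgn (s p.2)) / 2 else 0 := by
    unfold edgePhase edges
    rw [Finset.sum_filter]
    refine Finset.sum_congr rfl fun p _ => ?_
    by_cases h : p.1 < p.2 <;> by_cases h' : G.Adj p.1 p.2 <;> simp [h, h', angle]
  have h2 : edgePhase G θ s = ∑ p : Fin n × Fin n,
      if p.2 < p.1 then angle G θ p.1 p.2 * (sgn (s p.1) * sgn (s p.2)) / 2 else 0 := by
    rw [h1, ← Equiv.sum_comp (Equiv.prodComm (Fin n) (Fin n))]
    refine Finset.sum_congr rfl fun p _ => ?_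
    simp only [Equiv.prodComm_apply, Prod.fst_swap, Prod.snd_swap, angle_comm hθ p.2 p.1,
      mul_comm (sgn (s p.2))]
  have h3 : edgePhase G θ s + edgePhase G θ s = ∑ p : Fin n × Fin n,
      angle G θ p.1 p.2 * (sgn (s p.1) * sgn (s p.2)) / 2 := by
    nth_rewrite 1 [h1]
    rw [h2, ← Finset.sum_add_distrib]
    refine Finset.sum_congr rfl fun p _ => ?_
    rcases lt_trichotomy p.1 p.2 with h | h | h
    · simp [h, h.not_gt]
    · rw [h, angle_self]; simp
    · simp [h, h.not_gt]
  rw [← Fintype.sum_prod_type' fun k l => angle G θ k l * (sgn (s k) * sgn (s l))]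
  rw [← Finset.sum_div] at h3
  linarith

theorem sgn_flip (i : Fin n) (s : Fin n → Bool) (k : Fin n) :
    sgn (flip i s k) = sgn (s k) - 2 * (if k = i then sgn (s i) else 0) := by
  split_ifs with h
  · rw [h, flip_same, sgn_not]; ring
  · rw [flip_of_ne h]; ring

/-- Only the terms containing `i` change, and they change sign, so the difference is twice their
sum. -/
theorem edgePhase_sub_flip (hθ : ∀ k l, θ k l = θ l k) (i : Fin n) (s : Fin n → Bool) :
    edgePhase G θ s - edgePhase G θ (flip i s) =
      sgn (s i) * ∑ l, angle G θ i l * sgn (s l) := by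
  have h1 : ∀ k l, angle G θ k l * (sgn (s k) * sgn (s l)) -
      angle G θ k l * (sgn (flip i s k) * sgn (flip i s l)) =
      2 * ((if k = i then angle G θ i l * (sgn (s i) * sgn (s l)) else 0) +
        (if l = i then angle G θ i k * (sgn (s i) * sgn (s k)) else 0)) := fun k l => by
    rw [sgn_flip, sgn_flip]
    by_cases hk : k = i <;> by_cases hl : l = i
    · subst hk; subst hl; simp [angle_self]
    · subst hk; simp [hl]; ring
    · subst hl; simp [hk, angle_comm hθ l k]; ring
    · simp [hk, hl]
  rw [edgePhase_eq hθ, edgePhase_eq hθ, ← sub_div, ← Finset.sum_sub_distrib]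
  simp only [← Finset.sum_sub_distrib, h1, ← Finset.mul_sum, Finset.sum_add_distrib]
  rw [Finset.sum_comm]
  simp only [Finset.sum_ite_eq', Finset.mem_univ, if_true]
  simp only [mul_left_comm _ (sgn (s i)), ← Finset.mul_sum]
  ring

theorem sum_eq_pair_add {i j : Fin n} (hij : i ≠ j) (a : Fin n → ℝ) :
    ∑ l, a l = a i + a j + ∑ l ∈ {i, j}ᶜ, a l := by
  rw [← Finset.sum_add_sum_compl {i, j}, Finset.sum_pair hij]

/-- Summation over signs when all factors depend on the signs at `i` and `j`. -/
theorem sum_prod_eq {i j : Fin n} (hij : i ≠ j) (F : Bool → Bool → ℂ)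
    (g : Bool → Bool → Fin n → Bool → ℂ) :
    ∑ s : Fin n → Bool, F (s i) (s j) * ∏ l ∈ {i, j}ᶜ, g (s i) (s j) l (s l) =
      ∑ a, ∑ b, F a b * ∏ l ∈ {i, j}ᶜ, ∑ c, g a b l c := by
  have split : ∀ h : Fin n → ℂ, ∏ l, h l = h i * h j * ∏ l ∈ {i, j}ᶜ, h l := fun h => by
    rw [← Finset.prod_mul_prod_compl {i, j}, Finset.prod_pair hij]
  -- Indicators at `i` and `j` freeze the two signs, so that the sum of products over all sign
  -- vectors factorizes.
  let H : Bool → Bool → Fin n → Bool → ℂ := fun a b l c =>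
    if l = i then (if c = a then 1 else 0) else if l = j then (if c = b then 1 else 0)
    else g a b l c
  have hH : ∀ a b l c, l ∈ ({i, j} : Finset (Fin n))ᶜ → H a b l c = g a b l c := by
    intro a b l c hl
    simp only [Finset.mem_compl, Finset.mem_insert, Finset.mem_singleton, not_or] at hl
    simp [H, hl.1, hl.2]
  have h1 : ∀ a b, ∏ l ∈ {i, j}ᶜ, ∑ c, g a b l c = ∑ s : Fin n → Bool, ∏ l, H a b l (s l) := by
    intro a b
    have h2 := Finset.prod_univ_sum (fun _ : Fin n => (univ : Finset Bool)) (H a b)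
    rw [Fintype.piFinset_univ] at h2
    rw [← h2, split]
    have h3 : ∑ c, H a b i c = 1 := by simp [H]
    have h4 : ∑ c, H a b j c = 1 := by simp [H, hij.symm]
    rw [h3, h4, one_mul, one_mul]
    exact Finset.prod_congr rfl fun l hl => Finset.sum_congr rfl fun c _ => (hH a b l c hl).symm
  simp only [h1, Finset.mul_sum]
  rw [Finset.sum_congr rfl fun a _ => Finset.sum_comm, Finset.sum_comm]
  refine Finset.sum_congr rfl fun s _ => ?_
  have h5 : ∀ a b, F a b * ∏ l, H a b l (s l) = if s i = a then (if s j = b then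
      F a b * ∏ l ∈ {i, j}ᶜ, g a b l (s l) else 0) else 0 := by
    intro a b
    have h6 : H a b i (s i) = if s i = a then 1 else 0 := by simp [H]
    have h7 : H a b j (s j) = if s j = b then 1 else 0 := by simp [H, hij.symm]
    rw [split, h6, h7, Finset.prod_congr rfl fun l hl => hH a b l (s l) hl]
    split_ifs <;> simp
  simp [h5]

theorem two_pow_eq {i j : Fin n} (hij : i ≠ j) :
    (2 : ℂ) ^ n = 4 * 2 ^ #({i, j} : Finset (Fin n))ᶜ := by
  have h : #({i, j} : Finset (Fin n))ᶜ + 2 = n := by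
    have := Finset.card_add_card_compl ({i, j} : Finset (Fin n))
    rw [Finset.card_pair hij, Fintype.card_fin] at this
    omega
  conv_lhs => rw [← h]
  ring

theorem sum_exp_sgn (x : ℝ) :
    ∑ c, Complex.exp (Complex.I * ((x * sgn c : ℝ) : ℂ)) = 2 * Real.cos x := by
  have h := Complex.two_cos (x : ℂ)
  simp only [Fintype.sum_bool, sgn, if_true, Bool.false_eq_true, if_false]
  rw [Complex.ofReal_cos, h]
  congr 1 <;> congr 1 <;> push_cast <;> ring

theorem exp_I_sum {ι : Type*} (s : Finset ι) (x : ι → ℝ) :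
    Complex.exp (Complex.I * ((∑ l ∈ s, x l : ℝ) : ℂ)) =
      ∏ l ∈ s, Complex.exp (Complex.I * (x l : ℂ)) := by
  rw [← Complex.exp_sum, ← Finset.mul_sum]; push_cast; rfl

/-- The `ZZ` correlation of the output state. -/
theorem dotProduct_ZZ (hθ : ∀ k l, θ k l = θ l k) {i j : Fin n} (hij : i ≠ j) :
    dotProduct (star ((circuit G θ).mulVec (zeroState n)))
      ((site .Z i * site .Z j).mulVec ((circuit G θ).mulVec (zeroState n))) =
      (((∏ l ∈ {i, j}ᶜ, Real.cos (angle G θ i l + angle G θ j l) +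
        ∏ l ∈ {i, j}ᶜ, Real.cos (angle G θ i l - angle G θ j l)) / 2 : ℝ) : ℂ) := by
  rw [dotProduct_circuit_zeroState G θ (π := fun s => flip i (flip j s)) (c := fun _ => 1)
    (fun s => by rw [← Matrix.mulVec_mulVec, Z_signVec, Z_signVec, one_smul])]
  -- The edge `ij` drops out: flipping both ends preserves the product of their signs.
  have hphase : ∀ s, edgePhase G θ s - edgePhase G θ (flip i (flip j s)) =
      ∑ l ∈ {i, j}ᶜ, (angle G θ i l * sgn (s i) + angle G θ j l * sgn (s j)) * sgn (s l) := by
    intro s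
    have h1 := edgePhase_sub_flip (G := G) hθ j s
    have h2 := edgePhase_sub_flip (G := G) hθ i (flip j s)
    have h3 : ∑ l ∈ {i, j}ᶜ, angle G θ i l * sgn (flip j s l) =
        ∑ l ∈ {i, j}ᶜ, angle G θ i l * sgn (s l) := Finset.sum_congr rfl fun l hl => by
      simp only [Finset.mem_compl, Finset.mem_insert, Finset.mem_singleton, not_or] at hl
      rw [flip_of_ne hl.2]
    rw [sum_eq_pair_add hij] at h1 h2
    rw [h3, flip_of_ne hij, flip_same, sgn_not, angle_self] at h2
    rw [angle_self, angle_comm hθ j i] at h1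
    have h4 : ∑ l ∈ {i, j}ᶜ, (angle G θ i l * sgn (s i) + angle G θ j l * sgn (s j)) * sgn (s l) =
        sgn (s i) * ∑ l ∈ {i, j}ᶜ, angle G θ i l * sgn (s l) +
          sgn (s j) * ∑ l ∈ {i, j}ᶜ, angle G θ j l * sgn (s l) := by
      rw [Finset.mul_sum, Finset.mul_sum, ← Finset.sum_add_distrib]
      exact Finset.sum_congr rfl fun l _ => by ring
    rw [h4]
    linarith
  simp only [hphase, exp_I_sum]
  rw [sum_prod_eq hij (fun _ _ => 1) fun a b l c => Complex.exp (Complex.I *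
    (((angle G θ i l * sgn a + angle G θ j l * sgn b) * sgn c : ℝ) : ℂ))]
  -- Each remaining sign sums to twice a cosine. Equal signs at `i` and `j` give the cosine of the
  -- sum of angles, opposite ones that of the difference.
  simp only [sum_exp_sgn, Finset.prod_mul_distrib, Finset.prod_const]
  simp only [Fintype.sum_bool, sgn, if_true, Bool.false_eq_true, if_false, mul_one, mul_neg,
    one_mul]
  have h1 : ∏ l ∈ {i, j}ᶜ, ((Real.cos (-angle G θ i l + angle G θ j l) : ℝ) : ℂ) =
      ∏ l ∈ {i, j}ᶜ, ((Real.cos (angle G θ i l - angle G θ j l) : ℝ) : ℂ) :=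
    Finset.prod_congr rfl fun l _ => by rw [← Real.cos_neg]; congr 2; ring
  have h2 : ∏ l ∈ {i, j}ᶜ, ((Real.cos (-angle G θ i l + -angle G θ j l) : ℝ) : ℂ) =
      ∏ l ∈ {i, j}ᶜ, ((Real.cos (angle G θ i l + angle G θ j l) : ℝ) : ℂ) :=
    Finset.prod_congr rfl fun l _ => by rw [← Real.cos_neg]; congr 2; ring
  simp only [← sub_eq_add_neg (angle G θ i _)]
  rw [h1, h2, two_pow_eq hij]
  push_cast
  have h3 : (2 : ℂ) ^ #({i, j} : Finset (Fin n))ᶜ ≠ 0 :=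
    pow_ne_zero _ two_ne_zero
  field_simp
  ring

/-- The correlation of `X_i + Y_i` and `X_j - Y_j` in the output state. -/
theorem dotProduct_PM (hθ : ∀ k l, θ k l = θ l k) {i j : Fin n} (hij : i ≠ j) :
    dotProduct (star ((circuit G θ).mulVec (zeroState n)))
      (((site .X i + site .Y i) * xMinusY j).mulVec ((circuit G θ).mulVec (zeroState n))) =
      ((2 * (Real.sin (angle G θ i j) * ∏ l ∈ {i, j}ᶜ, Real.cos (angle G θ i l)) : ℝ) : ℂ) := by
  -- `X_j - Y_j` is diagonal and `X_i + Y_i` flips `i`; their scalars `√2` and `-√2 i` combine to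
  -- `-2 i`.
  rw [dotProduct_circuit_zeroState G θ (π := flip i)
    (c := fun s => -2 * Complex.I * (sgn (s i) * sgn (s j)))
    (fun s => by
      rw [← Matrix.mulVec_mulVec, xMinusY_signVec, Matrix.mulVec_smul, xPlusY_signVec, smul_smul]
      congr 1
      linear_combination (-Complex.I * sgn (s i) * sgn (s j)) * sqrt_two_sq)]
  have hphase : ∀ s, Complex.exp (Complex.I *
      ((edgePhase G θ s - edgePhase G θ (flip i s) : ℝ) : ℂ)) =
      Complex.exp (Complex.I * ((angle G θ i j * (sgn (s i) * sgn (s j)) : ℝ) : ℂ)) *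
      ∏ l ∈ {i, j}ᶜ,
        Complex.exp (Complex.I * (((angle G θ i l * sgn (s i)) * sgn (s l) : ℝ) : ℂ)) := by
    intro s
    rw [← exp_I_sum, ← Complex.exp_add, ← mul_add, ← Complex.ofReal_add,
      edgePhase_sub_flip hθ, sum_eq_pair_add hij, angle_self]
    have h : sgn (s i) * ∑ l ∈ {i, j}ᶜ, angle G θ i l * sgn (s l) =
        ∑ l ∈ {i, j}ᶜ, angle G θ i l * sgn (s i) * sgn (s l) := by
      rw [Finset.mul_sum]
      exact Finset.sum_congr rfl fun l _ => by ring
    rw [← h]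
    congr 3
    ring
  simp only [hphase, ← mul_assoc]
  rw [sum_prod_eq hij (fun a b => -2 * Complex.I * sgn a * sgn b *
    Complex.exp (Complex.I * ((angle G θ i j * (sgn a) * sgn b : ℝ) : ℂ))) fun a b l c =>
      Complex.exp (Complex.I * (((angle G θ i l * sgn a) * sgn c : ℝ) : ℂ))]
  simp only [sum_exp_sgn, Finset.prod_mul_distrib, Finset.prod_const]
  simp only [Fintype.sum_bool, sgn, if_true, Bool.false_eq_true, if_false, mul_one, mul_neg,
    neg_neg, Real.cos_neg]
  rw [two_pow_eq hij]
  have h3 : (2 : ℂ) ^ #({i, j} : Finset (Fin n))ᶜ ≠ 0 :=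
    pow_ne_zero _ two_ne_zero
  have h4 : Complex.exp (Complex.I * (angle G θ i j : ℂ)) -
      Complex.exp (Complex.I * (-(angle G θ i j : ℂ))) =
        2 * Complex.I * Real.sin (angle G θ i j) := by
    have h := Complex.two_sin (angle G θ i j : ℂ)
    have e1 : Complex.I * -(angle G θ i j : ℂ) = -(angle G θ i j : ℂ) * Complex.I := by ring
    rw [e1, mul_comm Complex.I (angle G θ i j : ℂ), Complex.ofReal_sin]
    linear_combination (-Complex.I) * h -
      (Complex.exp (-(angle G θ i j : ℂ) * Complex.I) -
        Complex.exp ((angle G θ i j : ℂ) * Complex.I)) * Complex.I_sq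
  push_cast at h4 ⊢
  rw [mul_neg] at h4
  field_simp
  linear_combination (-2 * Complex.I) * (∏ l ∈ {i, j}ᶜ, Complex.cos (angle G θ i l : ℂ)) * h4 -
    4 * Complex.sin (angle G θ i j) * (∏ l ∈ {i, j}ᶜ, Complex.cos (angle G θ i l : ℂ)) *
      Complex.I_sq

end phases

/-- In the expanded sum of the two products the odd powers of `y` cancel and the even ones are
nonnegative. The induction carries `∏ (x - y) ≤ ∏ (x + y)` along to control the cross terms. -/
theorem two_mul_prod_le {ι : Type*} (s : Finset ι) (x y : ι → ℝ) (hx : ∀ i ∈ s, 0 ≤ x i)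
    (hy : ∀ i ∈ s, 0 ≤ y i) :
    2 * ∏ i ∈ s, x i ≤ ∏ i ∈ s, (x i - y i) + ∏ i ∈ s, (x i + y i) := by
  classical
  suffices h : 2 * ∏ i ∈ s, x i ≤ ∏ i ∈ s, (x i - y i) + ∏ i ∈ s, (x i + y i) ∧
      ∏ i ∈ s, (x i - y i) ≤ ∏ i ∈ s, (x i + y i) from h.1
  induction s using Finset.induction_on with
  | empty => norm_num
  | insert a s ha ih =>
    obtain ⟨h1, h2⟩ := ih (fun i hi => hx i (Finset.mem_insert_of_mem hi))
      fun i hi => hy i (Finset.mem_insert_of_mem hi)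
    have hxa := hx a (Finset.mem_insert_self a s)
    have hya := hy a (Finset.mem_insert_self a s)
    have h0 : 0 ≤ ∏ i ∈ s, x i :=
      Finset.prod_nonneg fun i hi => hx i (Finset.mem_insert_of_mem hi)
    rw [Finset.prod_insert ha, Finset.prod_insert ha, Finset.prod_insert ha]
    have h3 := mul_le_mul_of_nonneg_left h1 hxa
    have h4 := mul_le_mul_of_nonneg_left h2 hya
    have h5 := mul_le_mul_of_nonneg_left h2 hxa
    have h6 := mul_nonneg hya h0
    have h7 := mul_le_mul_of_nonneg_left h1 hya
    constructor <;> linarith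

/-! ### Energy of a single edge in the output state -/

section circuit

variable {n : ℕ} {G : SimpleGraph (Fin n)} {θ : Fin n → Fin n → ℝ}

/-- In this form each product in the `XX - YY` part has one factor diagonal in the sign basis and
one that flips a sign. -/
theorem edgeHam_eq (i j : Fin n) :
    edgeHam i j = (1 / 2 : ℝ) • (1 + ((1 / 2 : ℝ) • ((site .X i + site .Y i) * xMinusY j) +
      (1 / 2 : ℝ) • (xMinusY i * (site .X j + site .Y j))) + site .Z i * site .Z j) := by
  have h : (1 / 2 : ℝ) • ((site .X i + site .Y i) * xMinusY j) +
      (1 / 2 : ℝ) • (xMinusY i * (site .X j + site .Y j)) =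
      site .X i * site .X j - site .Y i * site .Y j := by
    rw [← smul_add, xMinusY, xMinusY]
    have : (site .X i + site .Y i) * (site .X j - site .Y j) +
        (site .X i - site .Y i) * (site .X j + site .Y j) =
        (2 : ℝ) • (site .X i * site .X j - site .Y i * site .Y j) := by
      rw [two_smul]; noncomm_ring
    rw [this, smul_smul]; norm_num
  rw [h, edgeHam, site_I, site_I, mul_one]
  congr 2
  abel

theorem energy_edgeHam_circuit (hθ : ∀ k l, θ k l = θ l k) {i j : Fin n} (hij : i ≠ j) :
    energy (edgeHam i j) ((circuit G θ).mulVec (zeroState n)) =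
      (1 + (∏ l ∈ {i, j}ᶜ, Real.cos (angle G θ i l) + ∏ l ∈ {i, j}ᶜ, Real.cos (angle G θ j l)) *
        Real.sin (angle G θ i j) +
        (∏ l ∈ {i, j}ᶜ, Real.cos (angle G θ i l + angle G θ j l) +
        ∏ l ∈ {i, j}ᶜ, Real.cos (angle G θ i l - angle G θ j l)) / 2) / 2 := by
  have hcomm : xMinusY i * (site .X j + site .Y j) =
      (site .X j + site .Y j) * xMinusY i := by
    unfold xMinusY
    exact (((site_commute _ _ hij).add_right (site_commute _ _ hij)).sub_left
      ((site_commute _ _ hij).add_right (site_commute _ _ hij))).eq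
  have h1 : energy 1 ((circuit G θ).mulVec (zeroState n)) = 1 := by
    rw [energy, Matrix.one_mulVec, norm_circuit_zeroState, Complex.one_re]
  have h2 : ∀ {k l : Fin n}, k ≠ l → energy ((site .X k + site .Y k) * xMinusY l)
      ((circuit G θ).mulVec (zeroState n)) =
      2 * (Real.sin (angle G θ k l) * ∏ m ∈ {k, l}ᶜ, Real.cos (angle G θ k m)) := fun hkl => by
    rw [energy, dotProduct_PM hθ hkl, Complex.ofReal_re]
  have h3 : energy (site .Z i * site .Z j) ((circuit G θ).mulVec (zeroState n)) =
      (∏ l ∈ {i, j}ᶜ, Real.cos (angle G θ i l + angle G θ j l) +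
        ∏ l ∈ {i, j}ᶜ, Real.cos (angle G θ i l - angle G θ j l)) / 2 := by
    rw [energy, dotProduct_ZZ hθ hij, Complex.ofReal_re]
  rw [edgeHam_eq, hcomm]
  simp only [energy_smul, energy_add, h1, h2 hij, h2 hij.symm, h3]
  rw [angle_comm hθ j i, Finset.pair_comm j i]
  ring

theorem edge_term_le_energy (hθ : ∀ k l, θ k l = θ l k) {i j : Fin n} (hij : i ≠ j)
    (hc : ∀ k l, 0 ≤ Real.cos (angle G θ k l)) (hs : ∀ k l, 0 ≤ Real.sin (angle G θ k l)) :
    (1 + (∏ l ∈ {i, j}ᶜ, Real.cos (angle G θ i l)) * (∏ l ∈ {i, j}ᶜ, Real.cos (angle G θ j l)) +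
      (∏ l ∈ {i, j}ᶜ, Real.cos (angle G θ i l) + ∏ l ∈ {i, j}ᶜ, Real.cos (angle G θ j l)) *
        Real.sin (angle G θ i j)) / 2 ≤
      energy (edgeHam i j) ((circuit G θ).mulVec (zeroState n)) := by
  rw [energy_edgeHam_circuit hθ hij]
  simp only [Real.cos_add, Real.cos_sub]
  have h := two_mul_prod_le ({i, j} : Finset (Fin n))ᶜ
    (fun l => Real.cos (angle G θ i l) * Real.cos (angle G θ j l))
    (fun l => Real.sin (angle G θ i l) * Real.sin (angle G θ j l))
    (fun l _ => mul_nonneg (hc _ _) (hc _ _)) (fun l _ => mul_nonneg (hs _ _) (hs _ _))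
  rw [← Finset.prod_mul_distrib]
  linarith

end circuit

/-! ### From edge bounds to the approximation ratio -/

section algorithm

variable {n : ℕ} {G : SimpleGraph (Fin n)} {w : Fin n × Fin n → ℝ}
  {Γ : Matrix (PauliMon n 2) (PauliMon n 2) ℝ} {ν : ℝ → ℝ}

theorem Acoef_eq_prod {i j : Fin n} :
    Acoef ν G Γ i j = ∏ l ∈ {i, j}ᶜ, Real.cos (angle G (fun k l => ν (gval Γ k l)) i l) := by
  classical
  unfold Acoef
  rw [Finset.prod_filter, ← Finset.prod_mul_prod_compl {i, j}, Finset.prod_eq_one, one_mul]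
  · refine Finset.prod_congr rfl fun l hl => ?_
    simp only [Finset.mem_compl, Finset.mem_insert, Finset.mem_singleton, not_or] at hl
    by_cases h : G.Adj i l <;> simp [angle, h, hl.2]
  · intro l hl
    rcases Finset.mem_insert.mp hl with rfl | hl
    · simp
    · simp [Finset.mem_singleton.mp hl]

/-- The energy of the output state is at least `ℓ(G)`. -/
theorem lower_le_energy (hw : PosWeight G w) (hc : ∀ x, 0 ≤ Real.cos (ν x))
    (hs : ∀ x, 0 ≤ Real.sin (ν x)) :
    lower ν G w Γ ≤ energy (eprHam G w) (outputState ν G Γ) := by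
  unfold lower eprHam
  rw [energy_sum]
  refine Finset.sum_le_sum fun e he => ?_
  rw [energy_smul]
  refine mul_le_mul_of_nonneg_left ?_ (hw e he).le
  have hθ : ∀ k l, (fun k l => ν (gval Γ k l)) k l = (fun k l => ν (gval Γ k l)) l k :=
    fun k l => by simp only [gval_comm Γ k l]
  have h := edge_term_le_energy (G := G) hθ (mem_edges.mp he).1.ne
    (fun k l => by unfold angle; split_ifs <;> simp [hc])
    (fun k l => by unfold angle; split_ifs <;> simp [hs])
  rw [angle_of_adj (mem_edges.mp he).2, ← Acoef_eq_prod, Finset.pair_comm, ← Acoef_eq_prod] at h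
  exact h

theorem energy_outputState_le : energy (eprHam G w) (outputState ν G Γ) ≤ lambdaMax (eprHam G w) :=
  energy_le_lambdaMax (eprHam_isHermitian G w) (norm_circuit_zeroState G _)

theorem lambdaMax_nonneg (hw : PosWeight G w) : 0 ≤ lambdaMax (eprHam G w) :=
  (Finset.sum_nonneg fun e he => (hw e he).le).trans (sum_weight_le_lambdaMax G w)

theorem upper_pos (hw : PosWeight G w) (hG : (edges G).Nonempty) (hΓ : IsSDPSolution G w Γ) :
    0 < upper G w Γ :=
  (Finset.sum_pos (fun e he => hw e he) hG).trans_le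
    ((sum_weight_le_lambdaMax G w).trans (lambdaMax_le_upper hΓ))

theorem lower_nonneg (hw : PosWeight G w) (hc : ∀ x, 0 ≤ Real.cos (ν x))
    (hs : ∀ x, 0 ≤ Real.sin (ν x)) : 0 ≤ lower ν G w Γ := by
  have hA : ∀ i j, 0 ≤ Acoef ν G Γ i j := fun i j => Finset.prod_nonneg fun k _ => hc _
  refine Finset.sum_nonneg fun e he => mul_nonneg (hw e he).le ?_
  have h1 := mul_nonneg (hA e.1 e.2) (hA e.2 e.1)
  have h2 := mul_nonneg (add_nonneg (hA e.1 e.2) (hA e.2 e.1)) (hs (gval Γ e.1 e.2))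
  linarith

theorem ratio_mul_upper_le (hw : PosWeight G w) (hG : (edges G).Nonempty)
    (hΓ : IsSDPSolution G w Γ) (hc : ∀ x, 0 ≤ Real.cos (ν x)) (hs : ∀ x, 0 ≤ Real.sin (ν x)) :
    ratio ν * upper G w Γ ≤ lower ν G w Γ := by
  rw [← le_div_iff₀ (upper_pos hw hG hΓ)]
  refine csInf_le ⟨0, ?_⟩ ⟨n, G, w, Γ, hw, hG, hΓ, rfl⟩
  rintro _ ⟨m, G', w', Γ', hw', hG', hΓ', rfl⟩
  exact div_nonneg (lower_nonneg hw' hc hs) (upper_pos hw' hG' hΓ').le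

theorem ratio_nonneg (hc : ∀ x, 0 ≤ Real.cos (ν x)) (hs : ∀ x, 0 ≤ Real.sin (ν x)) :
    0 ≤ ratio ν := by
  refine Real.sInf_nonneg ?_
  rintro _ ⟨m, G', w', Γ', hw', hG', hΓ', rfl⟩
  exact div_nonneg (lower_nonneg hw' hc hs) (upper_pos hw' hG' hΓ').le

theorem lambdaMax_eq_zero (hG : edges G = ∅) : lambdaMax (eprHam G w) = 0 := by
  obtain ⟨ψ, -, h⟩ := exists_energy_eq_lambdaMax (eprHam_isHermitian G w)
  rw [← h]
  simp [eprHam, hG, energy]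

theorem isApproximation_of_le_ratio {a : ℝ} (ha : a ≤ ratio ν) (hc : ∀ x, 0 ≤ Real.cos (ν x))
    (hs : ∀ x, 0 ≤ Real.sin (ν x)) : IsApproximation ν a := by
  intro n G w hw
  refine ⟨exists_isSDPSolution G w, fun Γ hΓ => ⟨?_, energy_outputState_le⟩⟩
  refine le_trans ?_ (lower_le_energy hw hc hs)
  -- The infimum ranges over graphs with an edge; an empty graph has `λmax = 0`.
  rcases (edges G).eq_empty_or_nonempty with hG | hG
  · rw [lambdaMax_eq_zero hG, mul_zero]
    exact lower_nonneg hw hc hs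
  · calc a * lambdaMax (eprHam G w) ≤ ratio ν * lambdaMax (eprHam G w) :=
          mul_le_mul_of_nonneg_right ha (lambdaMax_nonneg hw)
      _ ≤ ratio ν * upper G w Γ :=
          mul_le_mul_of_nonneg_left (lambdaMax_le_upper hΓ) (ratio_nonneg hc hs)
      _ ≤ lower ν G w Γ := ratio_mul_upper_le hw hG hΓ hc hs

theorem minBound_le_ratio {β : ℝ} {Θ Λ : ℝ → ℝ} (hβ : 1 / 2 < β) (hβ' : β ≤ 1)
    (hΘ : ThetaClass Θ) (hΛ : LambdaClass Θ β Λ) :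
    minBound β Θ Λ ≤ ratio (nu β Θ Λ) := by
  refine le_csInf ?_ ?_
  · obtain ⟨Γ, hΓ⟩ := exists_isSDPSolution (⊤ : SimpleGraph (Fin 2)) fun _ => 1
    exact ⟨_, 2, ⊤, fun _ => 1, Γ, fun _ _ => one_pos, ⟨(0, 1), mem_edges.mpr (by simp)⟩, hΓ, rfl⟩
  · rintro _ ⟨n, G, w, Γ, hw, hG, hΓ, rfl⟩
    rw [le_div_iff₀ (upper_pos hw hG hΓ), upper, lower, Finset.mul_sum]
    refine Finset.sum_le_sum fun e he => ?_
    rw [mul_left_comm]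
    exact mul_le_mul_of_nonneg_left
      (minBound_mul_le_edge hΓ.1 hΘ hΛ hβ hβ' (mem_edges.mp he).1.ne) (hw e he).le

end algorithm

end

end EPR

theorem mainTheorem5 (β : ℝ) (hβ : 1 / 2 < β) (hβ' : β ≤ 1)
    (Θ : ℝ → ℝ) (hΘ : EPR.ThetaClass Θ)
    (Λ : ℝ → ℝ) (hΛ : EPR.LambdaClass Θ β Λ) :
    EPR.IsApproximation (EPR.nu β Θ Λ) (EPR.ratio (EPR.nu β Θ Λ)) ∧
    EPR.minBound β Θ Λ ≤ EPR.ratio (EPR.nu β Θ Λ) ∧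
    EPR.IsApproximation (EPR.nu β Θ Λ) (EPR.minBound β Θ Λ) :=
  ⟨EPR.isApproximation_of_le_ratio le_rfl (EPR.cos_nu_nonneg β Θ Λ) (EPR.sin_nu_nonneg β Θ Λ),
    EPR.minBound_le_ratio hβ hβ' hΘ hΛ,
    EPR.isApproximation_of_le_ratio (EPR.minBound_le_ratio hβ hβ' hΘ hΛ)
      (EPR.cos_nu_nonneg β Θ Λ) (EPR.sin_nu_nonneg β Θ Λ)⟩
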